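/- Let $n\ge 1$ and let $L\subset\mathbb{R}^3$ be a (tame, unoriented) $n$-component link. A spanning surface of $L$ is a compact surface $\Sigma$ tamely embedded in $\mathbb{R}^3$ with $\partial\Sigma=L$; here a link or surface is called tame if some self-homeomorphism of $\mathbb{R}^3$ carries it onto a polygonal link, respectively onto a (finite, geometric) triangulated surface. Let $\chi$ denote the Euler characteristic. Define the non-orientable genus of $L$ by $$C(L)=\min\{\,2-\chi(\Sigma)-n \;:\; \Sigma \text{ is a connected non-orientable spanning surface of } L\,\}$$ and the orientable genus of $L$ by $$g(L)=\min\{\,g(\Sigma) \;:\; \Sigma \text{ is a connected orientable spanning surface of } L\,\},$$ where the genus $g(\Sigma)$ is determined by $\chi(\Sigma)=2-2g(\Sigma)-n$. (A minimum over an empty set is read as $\infty$; in particular the inequality below includes the claim that a connected non-orientable spanning surface exists whenever a connected orientable one does.) Then $$C(L)\le 2g(L)+1 .$$ -/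

import Mathlib

noncomputable section

namespace LinkGenus

/-- Euclidean three-space. -/
abbrev E3 : Type := EuclideanSpace ℝ (Fin 3)

/-! ### Links -/

/-- `A` is a polygonal knot: a simple closed polygon with `m ≥ 3` vertices
`v 0, …, v (m - 1)` (indices mod `m`).  Two different edges meet at most in a common endpoint. -/
def IsPolygonalKnot (A : Set E3) : Prop :=
  ∃ (m : ℕ) (v : ZMod m → E3), 3 ≤ m ∧ Function.Injective v ∧
    (∀ i j : ZMod m, i ≠ j →
      segment ℝ (v i) (v (i + 1)) ∩ segment ℝ (v j) (v (j + 1)) ⊆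
        {v i, v (i + 1)} ∩ {v j, v (j + 1)}) ∧
    A = ⋃ i, segment ℝ (v i) (v (i + 1))

/-- `A` is a disjoint union of `n` polygonal knots. -/
def IsPolygonalLink (n : ℕ) (A : Set E3) : Prop :=
  ∃ κ : Fin n → Set E3, (∀ i, IsPolygonalKnot (κ i)) ∧
    (∀ i j, i ≠ j → Disjoint (κ i) (κ j)) ∧ A = ⋃ i, κ i

/-- A (tame) `n`-component link in three-space: a subset that some self-homeomorphism of
three-space carries to a disjoint union of `n` polygonal knots. -/
structure Link (n : ℕ) where
  carrier : Set E3
  tame : ∃ h : E3 ≃ₜ E3, IsPolygonalLink n (h '' carrier)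

/-! ### Compact triangulated surfaces with boundary in three-space -/

/-- The faces of `K` with exactly `k` vertices. -/
def facesOfCard (K : Geometry.SimplicialComplex ℝ E3) (k : ℕ) : Set (Finset E3) :=
  {s | s ∈ K.faces ∧ s.card = k}

/-- The triangles of `K` that contain `e`. -/
def trianglesAt (K : Geometry.SimplicialComplex ℝ E3) (e : Finset E3) : Set (Finset E3) :=
  {t | t ∈ facesOfCard K 3 ∧ e ⊆ t}

/-- The graph formed by the vertices and edges of the link of the vertex `v` in `K`:
its vertices are the neighbours of `v`, and `a`, `b` are adjacent when `v, a, b` span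
a triangle of `K`. -/
def vertexLink (K : Geometry.SimplicialComplex ℝ E3) (v : E3) :
    SimpleGraph {w : E3 // w ≠ v ∧ ({v, w} : Finset E3) ∈ K.faces} where
  Adj a b := a ≠ b ∧ ({v, a.1, b.1} : Finset E3) ∈ K.faces
  symm := ⟨fun a b h => ⟨h.1.symm, by
    have h2 := h.2
    rwa [Finset.pair_comm a.1 b.1] at h2⟩⟩
  loopless := ⟨fun _ h => h.1 rfl⟩

/-- `K` triangulates a compact surface, possibly with boundary: it is finite, purely
two-dimensional, every edge lies in one or two triangles, and every vertex link is connected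
(by the edge condition a vertex link is then a path with at least one edge, or a cycle). -/
structure IsSurface (K : Geometry.SimplicialComplex ℝ E3) : Prop where
  finite : K.faces.Finite
  pure : ∀ s ∈ K.faces, ∃ t ∈ facesOfCard K 3, s ⊆ t
  card_le : ∀ s ∈ K.faces, s.card ≤ 3
  edge : ∀ e ∈ facesOfCard K 2, (trianglesAt K e).ncard ≤ 2
  link_connected : ∀ v ∈ K.vertices, (vertexLink K v).Connected

/-- The boundary of a triangulated surface: the union of the edges that lie in exactly
one triangle. -/
def boundary (K : Geometry.SimplicialComplex ℝ E3) : Set E3 :=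
  ⋃ e ∈ {e | e ∈ facesOfCard K 2 ∧ (trianglesAt K e).ncard = 1}, convexHull ℝ (e : Set E3)

/-- The Euler characteristic (vertices minus edges plus triangles) of a complex of
dimension at most two. -/
def eulerChar (K : Geometry.SimplicialComplex ℝ E3) : ℤ :=
  (facesOfCard K 1).ncard - (facesOfCard K 2).ncard + (facesOfCard K 3).ncard

/-- Orientability: all triangles can be oriented so that any two triangles with a common edge
induce opposite directions on it.  `ω a b c = 1` or `-1` says whether or not the ordering
`a, b, c` of the vertices of a triangle agrees with the chosen orientation. -/
def Orientable (K : Geometry.SimplicialComplex ℝ E3) : Prop :=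
  ∃ ω : E3 → E3 → E3 → ℤ,
    (∀ a b c : E3, ({a, b, c} : Finset E3) ∈ facesOfCard K 3 →
      (ω a b c = 1 ∨ ω a b c = -1) ∧ ω b a c = -ω a b c ∧ ω b c a = ω a b c) ∧
    (∀ a b c d : E3, c ≠ d → ({a, b, c} : Finset E3) ∈ facesOfCard K 3 →
      ({a, b, d} : Finset E3) ∈ facesOfCard K 3 → ω a b d = -ω a b c)

/-! ### Spanning surfaces and genera -/

/-- A (tame) spanning surface of the set `L`: an embedded compact surface in three-space with
boundary `L`, given by a self-homeomorphism `h` of three-space and a triangulated surface `K`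
in three-space whose boundary is `h '' L`.  The surface itself is `h ⁻¹' K.space`, triangulated
by `K` through `h`. -/
structure SpanningSurface (L : Set E3) where
  h : E3 ≃ₜ E3
  K : Geometry.SimplicialComplex ℝ E3
  isSurface : IsSurface K
  boundary_eq : boundary K = h '' L

namespace SpanningSurface

variable {L : Set E3}

/-- The underlying point set of a spanning surface. -/
def carrier (S : SpanningSurface L) : Set E3 := S.h ⁻¹' S.K.space

/-- The Euler characteristic of a spanning surface. -/
def χ (S : SpanningSurface L) : ℤ := eulerChar S.K

/-- Orientability of a spanning surface. -/
def IsOrientable (S : SpanningSurface L) : Prop := Orientable S.K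

end SpanningSurface

/-- The non-orientable genus `C(L)` of an `n`-component link: the minimum of `2 - χ(Σ) - n` over
the connected non-orientable spanning surfaces `Σ` (`⊤` if there were none). -/
def nonorientableGenus {n : ℕ} (L : Link n) : ℕ∞ :=
  ⨅ c ∈ {c : ℕ | ∃ S : SpanningSurface L.carrier, IsConnected S.carrier ∧ ¬ S.IsOrientable ∧
    (c : ℤ) = 2 - S.χ - n}, (c : ℕ∞)

/-- The orientable genus `g(L)` of an `n`-component link: the minimal genus of a connected
orientable spanning surface `Σ` (`⊤` if there were none), where the genus `g` of `Σ`
is determined by `χ(Σ) = 2 - 2 g - n`, as `Σ` has `n` boundary circles. -/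
def orientableGenus {n : ℕ} (L : Link n) : ℕ∞ :=
  ⨅ g ∈ {g : ℕ | ∃ S : SpanningSurface L.carrier, IsConnected S.carrier ∧ S.IsOrientable ∧
    S.χ = 2 - 2 * (g : ℤ) - n}, (g : ℕ∞)

end LinkGenus

end

/-!
The inequality holds because a crosscap can be added to a spanning surface along its boundary
without changing the type of the link. Let `K` triangulate a connected spanning surface (its
orientability plays no role), let `{a, b}` be an edge on the boundary and `{a, b, c}` the only
triangle at this edge. A small Möbius band `M` is attached to `K` along `{a, b}`. The union is
connected and not orientable, and its Euler characteristic is `χ(K) + χ(M) - χ([a, b]) = χ(K) - 1`,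
so a surface of genus `g` gives a non-orientable one with `2 - χ - n = 2 g + 1`. Its boundary arises
from that of `K` by replacing the segment `[a, b]` with the rest of the boundary pentagon of `M`,
and a homeomorphism of three-space supported near the edge realizes this replacement.

* The band is the five-vertex Möbius band, with triangles `{j, j + 1, j + 3}` modulo `5`. It embeds
  linearly with four vertices spanning a tetrahedron and the fifth at the barycentre, since
  the five points satisfy only one affine relation (`IsCentredTetrahedron`, `moebius`).
* Room for the band comes from a thin lens around the edge: a simplex of `K` that does not contain
  the edge recedes from it at least linearly (`exists_pos_mul_min_le_norm`), so a thin lens meets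
  these simplices at most in `a` and `b` (`exists_lens_inter_subset`). The triangle `{a, b, c}`
  itself is avoided by placing the band on the other side of the edge (`exists_centredTetrahedron`).
* Two surfaces that meet exactly in a common boundary edge are glued in `IsEdgeGluing`.
* The homeomorphism is a composition of maps that drag one interior point of a convex set to
  another one, linearly on the segments to the frontier (`exists_homeomorph_push`). Three of them
  move `[a, b]` to the pentagonal arc, because a linear functional increases along the arc
  (`exists_homeomorph_segment_to_arc`).
-/

noncomputable section

namespace LinkGenus

open Set
open Geometry (SimplicialComplex)

/-! ### Dragging a point of a convex set -/

section Push

open scoped Pointwise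

variable {E : Type*} [NormedAddCommGroup E]

theorem neg_vadd_mem_nhds_zero {Q : Set E} {p : E} (hp : p ∈ interior Q) :
    -p +ᵥ Q ∈ nhds (0 : E) := by
  have h : Q ∈ nhds p := mem_interior_iff_mem_nhds.1 hp
  have := (Homeomorph.vadd (-p) : E ≃ₜ E).isOpenMap.image_mem_nhds h
  simpa [← Set.image_vadd] using this

theorem mem_interior_neg_vadd {Q : Set E} {p w : E} :
    w - p ∈ interior (-p +ᵥ Q) ↔ w ∈ interior Q := by
  rw [interior_vadd, Set.mem_vadd_set_iff_neg_vadd_mem]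
  simp

theorem mem_frontier_neg_vadd {Q : Set E} {p w : E} :
    w - p ∈ frontier (-p +ᵥ Q) ↔ w ∈ frontier Q := by
  have : frontier (-p +ᵥ Q) = -p +ᵥ frontier Q := by
    simp only [frontier, closure_vadd, interior_vadd, Set.vadd_set_sdiff]
  rw [this, Set.mem_vadd_set_iff_neg_vadd_mem]
  simp

variable [NormedSpace ℝ E]

/-- The self-map of `E` that drags the interior point `p` of the convex set `Q` to `q`: it is
affine on each segment from `p` to a frontier point of `Q`, and is the identity outside `Q`. -/
def pushMap (Q : Set E) (p q w : E) : E :=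
  w + max 0 (1 - gauge (-p +ᵥ Q) (w - p)) • (q - p)

theorem convex_neg_vadd {Q : Set E} (hQ : Convex ℝ Q) (p : E) : Convex ℝ (-p +ᵥ Q) :=
  hQ.vadd _

theorem continuous_pushMap {Q : Set E} (hQ : Convex ℝ Q) {p q : E} (hp : p ∈ interior Q) :
    Continuous (pushMap Q p q) := by
  have := continuous_gauge (convex_neg_vadd hQ p) (neg_vadd_mem_nhds_zero hp)
  unfold pushMap
  fun_prop

theorem pushMap_of_notMem {Q : Set E} (hQ : Convex ℝ Q) {p q w : E} (hp : p ∈ interior Q)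
    (hw : w ∉ interior Q) : pushMap Q p q w = w := by
  have h : ¬ gauge (-p +ᵥ Q) (w - p) < 1 := by
    rwa [gauge_lt_one_iff_mem_interior (convex_neg_vadd hQ p) (neg_vadd_mem_nhds_zero hp),
      mem_interior_neg_vadd]
  have : max 0 (1 - gauge (-p +ᵥ Q) (w - p)) = 0 := max_eq_left (by linarith)
  simp [pushMap, this]

theorem gauge_neg_vadd_of_mem_frontier {Q : Set E} (hQ : Convex ℝ Q) {p x : E}
    (hp : p ∈ interior Q) (hx : x ∈ frontier Q) : gauge (-p +ᵥ Q) (x - p) = 1 := by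
  rwa [gauge_eq_one_iff_mem_frontier (convex_neg_vadd hQ p) (neg_vadd_mem_nhds_zero hp),
    mem_frontier_neg_vadd]

theorem pushMap_lineMap {Q : Set E} (hQ : Convex ℝ Q) {p q x : E} (hp : p ∈ interior Q)
    (hx : x ∈ frontier Q) {r : ℝ} (h0 : 0 ≤ r) (h1 : r ≤ 1) :
    pushMap Q p q (p + r • (x - p)) = q + r • (x - q) := by
  have hg : gauge (-p +ᵥ Q) (r • (x - p)) = r := by
    rw [gauge_smul_of_nonneg h0, gauge_neg_vadd_of_mem_frontier hQ hp hx, smul_eq_mul, mul_one]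
  have : p + r • (x - p) - p = r • (x - p) := by abel
  rw [pushMap, this, hg, max_eq_right (by linarith)]
  module

/-- Every interior point `w` of a bounded convex set lies on a segment from a given interior point
`p` to the frontier. The second interior point `q ≠ p` is needed for `w = p` only: it guarantees
that the frontier is not empty. -/
theorem exists_mem_frontier_eq_lineMap {Q : Set E} (hQ : Convex ℝ Q)
    (hb : Bornology.IsBounded Q) {p q w : E} (hp : p ∈ interior Q) (hw : w ∈ interior Q)
    (hq : q ∈ interior Q) (hpq : p ≠ q) :
    ∃ x ∈ frontier Q, ∃ r : ℝ, 0 ≤ r ∧ r ≤ 1 ∧ w = p + r • (x - p) := by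
  have hn := neg_vadd_mem_nhds_zero hp
  have habs : Absorbent ℝ (-p +ᵥ Q) := absorbent_nhds_zero hn
  have hvb : Bornology.IsVonNBounded ℝ (-p +ᵥ Q) := (NormedSpace.isVonNBounded_iff ℝ).2 (hb.vadd _)
  have key : ∀ w ∈ interior Q, w ≠ p →
      ∃ x ∈ frontier Q, ∃ r : ℝ, 0 ≤ r ∧ r ≤ 1 ∧ w = p + r • (x - p) := by
    intro w hw hne
    have hpos : 0 < gauge (-p +ᵥ Q) (w - p) :=
      (gauge_pos habs hvb).2 (sub_ne_zero.2 hne)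
    have hlt : gauge (-p +ᵥ Q) (w - p) < 1 := by
      rwa [gauge_lt_one_iff_mem_interior (convex_neg_vadd hQ p) hn, mem_interior_neg_vadd]
    set r := gauge (-p +ᵥ Q) (w - p) with hr
    refine ⟨p + r⁻¹ • (w - p), ?_, r, hpos.le, hlt.le, ?_⟩
    · rw [← mem_frontier_neg_vadd (p := p), ← gauge_eq_one_iff_mem_frontier
        (convex_neg_vadd hQ p) hn]
      have : p + r⁻¹ • (w - p) - p = r⁻¹ • (w - p) := by abel
      rw [this, gauge_smul_of_nonneg (inv_nonneg.2 hpos.le), smul_eq_mul, ← hr,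
        inv_mul_cancel₀ hpos.ne']
    · rw [add_sub_cancel_left, smul_smul, mul_inv_cancel₀ hpos.ne', one_smul]
      abel
  rcases eq_or_ne w p with rfl | hne
  · obtain ⟨x, hx, -⟩ := key q hq hpq.symm
    exact ⟨x, hx, 0, le_rfl, zero_le_one, by simp⟩
  · exact key w hw hne

theorem pushMap_pushMap {Q : Set E} (hQ : Convex ℝ Q) (hb : Bornology.IsBounded Q) {p q : E}
    (hp : p ∈ interior Q) (hq : q ∈ interior Q) (w : E) :
    pushMap Q q p (pushMap Q p q w) = w := by
  rcases eq_or_ne p q with rfl | hpq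
  · simp [pushMap]
  by_cases hw : w ∈ interior Q
  · obtain ⟨x, hx, r, h0, h1, rfl⟩ := exists_mem_frontier_eq_lineMap hQ hb hp hw hq hpq
    rw [pushMap_lineMap hQ hp hx h0 h1, pushMap_lineMap hQ hq hx h0 h1]
  · rw [pushMap_of_notMem hQ hp hw, pushMap_of_notMem hQ hq hw]

/-- An interior point `p` of a bounded convex set `Q` can be dragged to any other interior point
`q` by a homeomorphism that fixes the complement of the interior and carries the segments from
`p` to the frontier to the segments from `q`. -/
theorem exists_homeomorph_push {Q : Set E} (hQ : Convex ℝ Q) (hb : Bornology.IsBounded Q)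
    {p q : E} (hp : p ∈ interior Q) (hq : q ∈ interior Q) :
    ∃ Φ : E ≃ₜ E, (∀ w ∉ interior Q, Φ w = w) ∧
      ∀ x ∈ frontier Q, Φ '' segment ℝ p x = segment ℝ q x := by
  refine ⟨⟨⟨pushMap Q p q, pushMap Q q p, pushMap_pushMap hQ hb hp hq,
    pushMap_pushMap hQ hb hq hp⟩, continuous_pushMap hQ hp, continuous_pushMap hQ hq⟩,
    fun w hw => pushMap_of_notMem hQ hp hw, fun x hx => ?_⟩
  rw [segment_eq_image', segment_eq_image', Set.image_image]
  exact Set.image_congr fun r hr => pushMap_lineMap hQ hp hx hr.1 hr.2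

theorem segment_eq_segment_union_segment {x z p : E} (hp : p ∈ segment ℝ x z) :
    segment ℝ x z = segment ℝ p x ∪ segment ℝ p z := by
  rw [segment_eq_image_lineMap] at hp
  obtain ⟨t, ht, rfl⟩ := hp
  have h0 := image_segment ℝ (AffineMap.lineMap x z : ℝ →ᵃ[ℝ] E)
  have hx : segment ℝ (AffineMap.lineMap x z t) x =
      (AffineMap.lineMap x z : ℝ →ᵃ[ℝ] E) '' Icc 0 t := by
    rw [← segment_eq_Icc ht.1, h0, AffineMap.lineMap_apply_zero, segment_symm]
  have hz : segment ℝ (AffineMap.lineMap x z t) z =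
      (AffineMap.lineMap x z : ℝ →ᵃ[ℝ] E) '' Icc t 1 := by
    rw [← segment_eq_Icc ht.2, h0, AffineMap.lineMap_apply_one]
  rw [hx, hz, ← Set.image_union, Icc_union_Icc_eq_Icc ht.1 ht.2, segment_eq_image_lineMap]

/-- The elementary move of polygonal links: inside a convex set `Q` the segment from `x` to `z`
is replaced by the broken line through `y`. -/
theorem exists_homeomorph_bend {Q A : Set E} (hQ : Convex ℝ Q) (hb : Bornology.IsBounded Q)
    {x y z p : E} (hx : x ∈ frontier Q) (hz : z ∈ frontier Q) (hp : p ∈ interior Q)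
    (hy : y ∈ interior Q) (hxz : p ∈ segment ℝ x z) (hA : Disjoint A (interior Q)) :
    ∃ Φ : E ≃ₜ E, Φ '' (A ∪ segment ℝ x z) = A ∪ segment ℝ x y ∪ segment ℝ y z := by
  obtain ⟨Φ, h1, h2⟩ := exists_homeomorph_push hQ hb hp hy
  refine ⟨Φ, ?_⟩
  have hseg : segment ℝ x z = segment ℝ p x ∪ segment ℝ p z :=
    segment_eq_segment_union_segment hxz
  have hAA : Φ '' A = A := by
    conv_rhs => rw [← Set.image_id A]
    exact Set.image_congr fun w hw => h1 w (Set.disjoint_left.1 hA hw)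
  rw [hseg, Set.image_union, Set.image_union, h2 x hx, h2 z hz, hAA, segment_symm ℝ x y,
    Set.union_assoc]

/-- A segment `[a, b]` that crosses the interior of a bounded convex set `Q` from frontier to
frontier can be moved to a broken line with three inner vertices in the interior of `Q`, provided
that a linear functional increases along the vertices of the line. A set `A` that avoids the
interior of `Q` is not affected. -/
theorem exists_homeomorph_segment_to_arc {Q A : Set E} (hQ : Convex ℝ Q)
    (hcl : IsClosed Q)
    (hb : Bornology.IsBounded Q) (f : E →L[ℝ] ℝ) {a b w₁ w₂ w₃ : E} (ha : a ∈ frontier Q)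
    (hb' : b ∈ frontier Q) (hm : ∃ m ∈ segment ℝ a b, m ∈ interior Q) (h1 : w₁ ∈ interior Q)
    (h2 : w₂ ∈ interior Q) (h3 : w₃ ∈ interior Q) (hA : Disjoint A (interior Q))
    (h01 : f a < f w₁) (h12 : f w₁ < f w₂) (h23 : f w₂ < f w₃) (h34 : f w₃ < f b) :
    ∃ Φ : E ≃ₜ E, Φ '' (A ∪ segment ℝ a b) = A ∪ segment ℝ a w₁ ∪ segment ℝ w₁ w₂ ∪
      segment ℝ w₂ w₃ ∪ segment ℝ w₃ b := by
  have hfopen : ∀ r : ℝ, IsOpen {x | r < f x} := fun r => isOpen_lt continuous_const f.continuous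
  have hfle : ∀ x : E, ∀ w ∈ interior (Q ∩ {y | f x ≤ f y}), f x < f w := by
    intro x w hw
    have hf : f ≠ 0 := by
      rintro rfl
      simp at h01
    have hsub : f '' interior (Q ∩ {y | f x ≤ f y}) ⊆ interior (Ici (f x)) :=
      interior_maximal (image_subset_iff.2 fun v hv => (interior_subset hv).2)
        (f.isOpenMap_of_ne_zero hf _ isOpen_interior)
    simpa using hsub (mem_image_of_mem f hw)
  -- one move, in the part of `Q` beyond the level of the last vertex reached
  have step : ∀ (A : Set E) (x y : E), Disjoint A (interior (Q ∩ {y | f x ≤ f y})) →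
      x ∈ interior Q → y ∈ interior Q → f x < f y → f x < f b →
      ∃ Φ : E ≃ₜ E, Φ '' (A ∪ segment ℝ x b) = A ∪ segment ℝ x y ∪ segment ℝ y b := by
    intro A x y hA hx hy hxy hxb
    have hC : Convex ℝ (Q ∩ {y | f x ≤ f y}) :=
      hQ.inter (convex_halfSpace_ge f.toLinearMap.isLinear _)
    have hint : ∀ w ∈ interior Q, f x < f w → w ∈ interior (Q ∩ {y | f x ≤ f y}) := by
      intro w hw hlt
      rw [interior_inter]
      exact ⟨hw, interior_maximal (fun v (hv : f x < f v) => hv.le) (hfopen _) hlt⟩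
    refine exists_homeomorph_bend hC (hb.subset inter_subset_left) (p := midpoint ℝ x b)
      ⟨subset_closure ⟨interior_subset hx, le_refl (f x)⟩, fun h => (hfle x x h).false⟩
      ⟨subset_closure ⟨hcl.frontier_subset hb', hxb.le⟩,
        fun h => hb'.2 (interior_mono inter_subset_left h)⟩
      (hint _ ?_ ?_) (hint _ hy hxy) (midpoint_mem_segment x b) hA
    · exact hQ.openSegment_interior_closure_subset_interior hx hb'.1 (midpoint_mem_openSegment x b)
    · rw [midpoint_eq_smul_add, map_smul, map_add, smul_eq_mul, invOf_eq_inv]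
      linarith
  -- the part of the line that is already built lies below the region of the next move
  have low : ∀ x y : E, f x < f y →
      Disjoint (segment ℝ x y) (interior (Q ∩ {w | f y ≤ f w})) := by
    intro x y hxy
    rw [Set.disjoint_left]
    intro w hw hw'
    have hle : f w ≤ f y :=
      (convex_halfSpace_le f.toLinearMap.isLinear (f y)).segment_subset hxy.le (le_refl (f y)) hw
    exact (hfle y w hw').not_ge hle
  have hA' : ∀ x, Disjoint A (interior (Q ∩ {w | f x ≤ f w})) := fun x =>
    hA.mono_right (interior_mono inter_subset_left)
  obtain ⟨m, hm, hmQ⟩ := hm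
  obtain ⟨Φ₁, hΦ₁⟩ := exists_homeomorph_bend hQ hb ha hb' hmQ h1 hm hA
  have hl1 := low a w₁ h01
  obtain ⟨Φ₂, hΦ₂⟩ := step (A ∪ segment ℝ a w₁) w₁ w₂
    ((hA' _).union_left hl1) h1 h2 h12 (by linarith)
  have lower : ∀ S : Set E, Disjoint S (interior (Q ∩ {w | f w₁ ≤ f w})) →
      Disjoint S (interior (Q ∩ {w | f w₂ ≤ f w})) := fun S hS =>
    hS.mono_right (interior_mono (inter_subset_inter_right _ fun _ hw => h12.le.trans hw))
  obtain ⟨Φ₃, hΦ₃⟩ := step (A ∪ segment ℝ a w₁ ∪ segment ℝ w₁ w₂) w₂ w₃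
    (((hA' _).union_left (lower _ hl1)).union_left (low w₁ w₂ h12)) h2 h3 h23 (by linarith)
  refine ⟨(Φ₁.trans Φ₂).trans Φ₃, ?_⟩
  have h : ∀ S : Set E, (Φ₁.trans Φ₂).trans Φ₃ '' S = Φ₃ '' (Φ₂ '' (Φ₁ '' S)) := fun S => by
    rw [Set.image_image, Set.image_image]
    rfl
  rw [h, hΦ₁, hΦ₂, hΦ₃]

end Push

/-! ### Gluing two triangulated surfaces along a boundary edge -/

section Gluing

/-- `G` is the union of the complexes `K` and `M`, whose common faces are exactly the edge
`{a, b}` and its end points. -/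
structure IsEdgeGluing (G K M : SimplicialComplex ℝ E3) (a b : E3) : Prop where
  ne : a ≠ b
  faces_eq : G.faces = K.faces ∪ M.faces
  mem_left : ({a, b} : Finset E3) ∈ K.faces
  mem_right : ({a, b} : Finset E3) ∈ M.faces
  common : ∀ s ∈ K.faces, s ∈ M.faces → s ⊆ ({a, b} : Finset E3)

/-- Two complexes with a common edge glue to a complex as soon as their spaces meet only in that
edge. -/
theorem exists_isEdgeGluing {K M : SimplicialComplex ℝ E3} {a b : E3} (hab : a ≠ b)
    (hK : ({a, b} : Finset E3) ∈ K.faces) (hM : ({a, b} : Finset E3) ∈ M.faces)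
    (h : K.space ∩ M.space ⊆ segment ℝ a b) :
    ∃ G : SimplicialComplex ℝ E3, IsEdgeGluing G K M a b := by
  have hseg : segment ℝ a b = convexHull ℝ (({a, b} : Finset E3) : Set E3) := by
    rw [Finset.coe_pair, convexHull_pair]
  rw [hseg] at h
  have cross : ∀ {K M : SimplicialComplex ℝ E3}, ({a, b} : Finset E3) ∈ K.faces →
      ({a, b} : Finset E3) ∈ M.faces →
      K.space ∩ M.space ⊆ convexHull ℝ (({a, b} : Finset E3) : Set E3) →
      ∀ {s t}, s ∈ K.faces → t ∈ M.faces →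
      convexHull ℝ ↑s ∩ convexHull ℝ ↑t ⊆ convexHull ℝ (s ∩ t : Set E3) := by
    intro K M hK hM h s t hs ht x ⟨hxs, hxt⟩
    have hxe := h ⟨SimplicialComplex.convexHull_subset_space hs hxs,
      SimplicialComplex.convexHull_subset_space ht hxt⟩
    have h1 := K.inter_subset_convexHull hK hs ⟨hxe, hxs⟩
    rw [← Finset.coe_inter] at h1
    have hne : (({a, b} : Finset E3) ∩ s).Nonempty := by
      rw [Finset.nonempty_iff_ne_empty]
      intro h0
      simp [h0] at h1
    have h2 := M.inter_subset_convexHull (M.down_closed hM Finset.inter_subset_left hne) ht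
      ⟨h1, hxt⟩
    refine convexHull_mono ?_ h2
    rw [Finset.coe_inter]
    exact inter_subset_inter_left _ inter_subset_right
  refine ⟨{ faces := K.faces ∪ M.faces
            isRelLowerSet_faces := K.isRelLowerSet_faces.union M.isRelLowerSet_faces
            indep := ?_
            inter_subset_convexHull := ?_ }, ⟨hab, rfl, hK, hM, ?_⟩⟩
  · rintro s (hs | hs)
    exacts [K.indep hs, M.indep hs]
  · rintro s t (hs | hs) (ht | ht)
    · exact K.inter_subset_convexHull hs ht
    · exact cross hK hM h hs ht
    · exact cross hM hK (by rwa [inter_comm]) hs ht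
    · exact M.inter_subset_convexHull hs ht
  · intro s hs hs'
    refine (K.face_subset_face_iff hs hK).1 fun x hx => h ⟨?_, ?_⟩
    · exact SimplicialComplex.convexHull_subset_space hs hx
    · exact SimplicialComplex.convexHull_subset_space hs' hx

/-- The edges that lie in exactly one triangle. -/
def boundaryEdges (K : SimplicialComplex ℝ E3) : Set (Finset E3) :=
  {e | e ∈ facesOfCard K 2 ∧ (trianglesAt K e).ncard = 1}

theorem boundary_eq_biUnion (K : SimplicialComplex ℝ E3) :
    boundary K = ⋃ e ∈ boundaryEdges K, convexHull ℝ (e : Set E3) := rfl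

namespace IsEdgeGluing

variable {G K M : SimplicialComplex ℝ E3} {a b : E3}

theorem symm (h : IsEdgeGluing G K M a b) : IsEdgeGluing G M K a b :=
  ⟨h.ne, h.faces_eq.trans (union_comm _ _), h.mem_right, h.mem_left, fun s hs hs' =>
    h.common s hs' hs⟩

theorem swap (h : IsEdgeGluing G K M a b) : IsEdgeGluing G K M b a := by
  obtain ⟨h1, h2, h3, h4, h5⟩ := h
  rw [Finset.pair_comm] at h3 h4 h5
  exact ⟨h1.symm, h2, h3, h4, h5⟩

theorem facesOfCard_eq (h : IsEdgeGluing G K M a b) (k : ℕ) :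
    facesOfCard G k = facesOfCard K k ∪ facesOfCard M k := by
  ext s
  simp only [facesOfCard, h.faces_eq, mem_union, mem_ofPred_eq]
  tauto

theorem trianglesAt_eq (h : IsEdgeGluing G K M a b) (e : Finset E3) :
    trianglesAt G e = trianglesAt K e ∪ trianglesAt M e := by
  ext s
  simp only [trianglesAt, h.facesOfCard_eq, mem_union, mem_ofPred_eq]
  tauto

theorem card_pair (h : IsEdgeGluing G K M a b) : ({a, b} : Finset E3).card = 2 :=
  Finset.card_pair h.ne

theorem trianglesAt_right_eq_empty (h : IsEdgeGluing G K M a b) {e : Finset E3}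
    (he : e ∈ facesOfCard K 2) (hne : e ≠ {a, b}) : trianglesAt M e = ∅ := by
  rw [Set.eq_empty_iff_forall_notMem]
  rintro t ⟨ht, het⟩
  have heM : e ∈ M.faces := M.down_closed ht.1 het (K.nonempty_of_mem_faces he.1)
  exact hne (Finset.eq_of_subset_of_card_le (h.common e he.1 heM) (by rw [h.card_pair, he.2]))

theorem trianglesAt_left (h : IsEdgeGluing G K M a b) {e : Finset E3}
    (he : e ∈ facesOfCard K 2) (hne : e ≠ {a, b}) : trianglesAt G e = trianglesAt K e := by
  rw [h.trianglesAt_eq, h.trianglesAt_right_eq_empty he hne, union_empty]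

theorem ncard_trianglesAt_pair (h : IsEdgeGluing G K M a b) (hK : {a, b} ∈ boundaryEdges K)
    (hM : {a, b} ∈ boundaryEdges M) : (trianglesAt G {a, b}).ncard = 2 := by
  obtain ⟨s, hs⟩ := Set.ncard_eq_one.1 hK.2
  obtain ⟨t, ht⟩ := Set.ncard_eq_one.1 hM.2
  rw [h.trianglesAt_eq, hs, ht, Set.singleton_union, Set.ncard_pair]
  rintro rfl
  have h1 : s ∈ trianglesAt K {a, b} := hs ▸ mem_singleton s
  have h2 : s ∈ trianglesAt M {a, b} := ht ▸ mem_singleton s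
  have := Finset.card_le_card (h.common s h1.1.1 h2.1.1)
  rw [h.card_pair, h1.1.2] at this
  omega

/-- The gluing edge becomes an inner edge; all other boundary edges are kept. -/
theorem boundaryEdges_eq (h : IsEdgeGluing G K M a b) (hK : {a, b} ∈ boundaryEdges K)
    (hM : {a, b} ∈ boundaryEdges M) :
    boundaryEdges G = (boundaryEdges K \ {{a, b}}) ∪ (boundaryEdges M \ {{a, b}}) := by
  ext e
  by_cases hne : e = {a, b}
  · subst hne
    have := h.ncard_trianglesAt_pair hK hM
    constructor
    · intro h'
      have := h'.2
      omega
    · rintro (h' | h') <;> exact absurd rfl h'.2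
  have h1 : e ∈ facesOfCard K 2 → trianglesAt G e = trianglesAt K e := fun he =>
    h.trianglesAt_left he hne
  have h2 : e ∈ facesOfCard M 2 → trianglesAt G e = trianglesAt M e := fun he =>
    h.symm.trianglesAt_left he hne
  simp only [boundaryEdges, mem_union, mem_sdiff, mem_ofPred_eq, h.facesOfCard_eq,
    mem_singleton_iff, hne, not_false_eq_true, and_true]
  constructor
  · rintro ⟨he | he, hc⟩
    · exact Or.inl ⟨he, h1 he ▸ hc⟩
    · exact Or.inr ⟨he, h2 he ▸ hc⟩
  · rintro (⟨he, hc⟩ | ⟨he, hc⟩)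
    · exact ⟨Or.inl he, (h1 he).symm ▸ hc⟩
    · exact ⟨Or.inr he, (h2 he).symm ▸ hc⟩

theorem faces_left_subset (h : IsEdgeGluing G K M a b) : K.faces ⊆ G.faces :=
  h.faces_eq ▸ subset_union_left

/-- The inclusion of a vertex link of `K` into that of `G`. -/
def linkHom (h : IsEdgeGluing G K M a b) (v : E3) : vertexLink K v →g vertexLink G v where
  toFun w := ⟨w.1, w.2.1, h.faces_left_subset w.2.2⟩
  map_rel' hxy := ⟨fun hc => hxy.1 (Subtype.ext (Subtype.mk.inj hc)),
    h.faces_left_subset hxy.2⟩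

/-- At a vertex of `K` that is not a vertex of `M` the link is unchanged. -/
theorem link_connected_of_notMem (h : IsEdgeGluing G K M a b) {v : E3}
    (hK : (vertexLink K v).Connected) (hv : v ∉ M.vertices) : (vertexLink G v).Connected := by
  refine hK.map (h.linkHom v) fun ⟨w, hwv, hw⟩ => ?_
  rw [h.faces_eq] at hw
  rcases hw with hw | hw
  · exact ⟨⟨w, hwv, hw⟩, rfl⟩
  · exact absurd (M.down_closed hw (by simp) (Finset.singleton_nonempty v)) hv

/-- At an end point of the gluing edge the two vertex links are united along the other end
point. -/
theorem link_connected_left (h : IsEdgeGluing G K M a b) (hK : (vertexLink K a).Connected)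
    (hM : (vertexLink M a).Connected) : (vertexLink G a).Connected := by
  have hG : ({a, b} : Finset E3) ∈ G.faces := h.faces_left_subset h.mem_left
  have key : ∀ w, (vertexLink G a).Reachable w ⟨b, h.ne.symm, hG⟩ := by
    rintro ⟨w, hwv, hw⟩
    have hw' := hw
    rw [h.faces_eq] at hw'
    rcases hw' with hw' | hw'
    · exact (hK.preconnected ⟨w, hwv, hw'⟩ ⟨b, h.ne.symm, h.mem_left⟩).map (h.linkHom a)
    · exact (hM.preconnected ⟨w, hwv, hw'⟩ ⟨b, h.ne.symm, h.mem_right⟩).map (h.symm.linkHom a)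
  exact (SimpleGraph.connected_iff _).2 ⟨fun x y => (key x).trans (key y).symm,
    ⟨⟨b, h.ne.symm, hG⟩⟩⟩

theorem isSurface (h : IsEdgeGluing G K M a b) (hK : IsSurface K) (hM : IsSurface M)
    (heK : {a, b} ∈ boundaryEdges K) (heM : {a, b} ∈ boundaryEdges M) : IsSurface G where
  finite := by
    rw [h.faces_eq]
    exact hK.finite.union hM.finite
  pure s hs := by
    rw [h.faces_eq] at hs
    simp only [h.facesOfCard_eq]
    rcases hs with hs | hs
    · obtain ⟨t, ht, hst⟩ := hK.pure s hs
      exact ⟨t, Or.inl ht, hst⟩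
    · obtain ⟨t, ht, hst⟩ := hM.pure s hs
      exact ⟨t, Or.inr ht, hst⟩
  card_le s hs := by
    rw [h.faces_eq] at hs
    exact hs.elim (hK.card_le s) (hM.card_le s)
  edge e he := by
    rcases eq_or_ne e {a, b} with rfl | hne
    · exact (h.ncard_trianglesAt_pair heK heM).le
    rw [h.facesOfCard_eq] at he
    rcases he with he | he
    · exact (h.trianglesAt_left he hne).symm ▸ hK.edge e he
    · exact (h.symm.trianglesAt_left he hne).symm ▸ hM.edge e he
  link_connected v hv := by
    rw [SimplicialComplex.mem_vertices, h.faces_eq] at hv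
    by_cases hvK : {v} ∈ K.faces
    · by_cases hvM : {v} ∈ M.faces
      · have := h.common _ hvK hvM
        simp only [Finset.singleton_subset_iff, Finset.mem_insert, Finset.mem_singleton] at this
        rcases this with rfl | rfl
        · exact h.link_connected_left (hK.link_connected _ hvK) (hM.link_connected _ hvM)
        · exact h.swap.link_connected_left (hK.link_connected _ hvK) (hM.link_connected _ hvM)
      · exact h.link_connected_of_notMem (hK.link_connected _ hvK) hvM
    · have hvM := hv.resolve_left hvK
      exact h.symm.link_connected_of_notMem (hM.link_connected _ hvM) hvK

theorem ncard_facesOfCard (h : IsEdgeGluing G K M a b) (hK : K.faces.Finite)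
    (hM : M.faces.Finite) {k : ℕ} (hk : 0 < k) :
    (facesOfCard G k).ncard + Nat.choose 2 k =
      (facesOfCard K k).ncard + (facesOfCard M k).ncard := by
  have hinter : facesOfCard K k ∩ facesOfCard M k =
      (Finset.powersetCard k ({a, b} : Finset E3) : Set (Finset E3)) := by
    ext s
    simp only [facesOfCard, mem_inter_iff, mem_ofPred_eq, Finset.mem_coe, Finset.mem_powersetCard]
    constructor
    · rintro ⟨⟨h1, h2⟩, h3, -⟩
      exact ⟨h.common s h1 h3, h2⟩
    · rintro ⟨h1, h2⟩
      have hne : s.Nonempty := Finset.card_pos.1 (h2 ▸ hk)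
      exact ⟨⟨K.down_closed h.mem_left h1 hne, h2⟩, M.down_closed h.mem_right h1 hne, h2⟩
  rw [h.facesOfCard_eq, ← Set.ncard_union_add_ncard_inter _ _ (hK.subset fun s hs => hs.1)
    (hM.subset fun s hs => hs.1), hinter, Set.ncard_coe_finset, Finset.card_powersetCard,
    h.card_pair]

theorem eulerChar_eq (h : IsEdgeGluing G K M a b) (hK : K.faces.Finite) (hM : M.faces.Finite) :
    eulerChar G = eulerChar K + eulerChar M - 1 := by
  have h1 := h.ncard_facesOfCard hK hM (k := 1) (by norm_num)
  have h2 := h.ncard_facesOfCard hK hM (k := 2) (by norm_num)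
  have h3 := h.ncard_facesOfCard hK hM (k := 3) (by norm_num)
  norm_num [Nat.choose] at h1 h2 h3
  unfold eulerChar
  omega

theorem space_eq (h : IsEdgeGluing G K M a b) : G.space = K.space ∪ M.space := by
  simp only [SimplicialComplex.space, h.faces_eq, biUnion_union]

theorem isConnected_space (h : IsEdgeGluing G K M a b) (hK : IsConnected K.space)
    (hM : IsConnected M.space) : IsConnected G.space := by
  rw [h.space_eq]
  refine IsConnected.union ⟨a, ?_, ?_⟩ hK hM
  · exact SimplicialComplex.subset_space h.mem_left (by simp)
  · exact SimplicialComplex.subset_space h.mem_right (by simp)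

theorem orientable_right (h : IsEdgeGluing G K M a b) (hG : Orientable G) : Orientable M := by
  obtain ⟨ω, h1, h2⟩ := hG
  simp only [h.facesOfCard_eq] at h1 h2
  exact ⟨ω, fun a b c habc => h1 a b c (Or.inr habc), fun a b c d hcd hc hd =>
    h2 a b c d hcd (Or.inr hc) (Or.inr hd)⟩

end IsEdgeGluing

end Gluing

/-! ### The five-vertex Möbius band in a tetrahedron -/

section Moebius

/-- The nonempty faces of the five-vertex Möbius band, whose triangles are `{j, j + 1, j + 3}`
for `j` modulo `5`. -/
def moebiusFaces : Finset (Finset (Fin 5)) :=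
  {s | s.Nonempty ∧ ∃ j : Fin 5, s ⊆ {j, j + 1, j + 3}}

/-- Four of the points (`v 0, v 1, v 3, v 4`) span a tetrahedron with barycentre `v 2`: the
affine relations between the five points are the multiples of `v 0 + v 1 - 4 v 2 + v 3 + v 4`. -/
def IsCentredTetrahedron (v : Fin 5 ↪ E3) : Prop :=
  ∀ c : Fin 5 → ℝ, ∑ i, c i = 0 → ∑ i, c i • v i = 0 →
    ∃ κ : ℝ, ∀ i, c i = κ * (![1, 1, -4, 1, 1] : Fin 5 → ℝ) i

theorem card_le_of_mem_moebiusFaces {s : Finset (Fin 5)} (hs : s ∈ moebiusFaces) : s.card ≤ 3 := by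
  revert s
  decide

theorem mem_convexHull_map {v : Fin 5 ↪ E3} {s : Finset (Fin 5)} {x : E3} :
    x ∈ convexHull ℝ (s.map v : Set E3) ↔ ∃ w : Fin 5 → ℝ, (∀ i, 0 ≤ w i) ∧ (∀ i ∉ s, w i = 0) ∧
      ∑ i, w i = 1 ∧ ∑ i, w i • v i = x := by
  rw [Finset.mem_convexHull']
  constructor
  · rintro ⟨w, h0, h1, hx⟩
    simp only [Finset.sum_map] at h1 hx
    refine ⟨fun i => if i ∈ s then w (v i) else 0, fun i => ?_, fun i hi => if_neg hi, ?_, ?_⟩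
    · dsimp only
      split_ifs with hi
      · exact h0 _ (Finset.mem_map_of_mem v hi)
      · exact le_rfl
    · simpa [Finset.sum_ite_mem] using h1
    · simpa [ite_smul, Finset.sum_ite_mem] using hx
  · rintro ⟨w, h0, hs, h1, hx⟩
    refine ⟨fun y => w (Function.invFun v y), fun y _ => h0 _, ?_, ?_⟩
    · simp only [Finset.sum_map, Function.leftInverse_invFun v.injective _]
      rw [← h1]
      exact Finset.sum_subset (Finset.subset_univ s) fun i _ hi => hs i hi
    · simp only [Finset.sum_map, Function.leftInverse_invFun v.injective _]
      rw [← hx]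
      exact Finset.sum_subset (Finset.subset_univ s) fun i _ hi => by rw [hs i hi, zero_smul]

namespace IsCentredTetrahedron

variable {v : Fin 5 ↪ E3}

theorem indep (hv : IsCentredTetrahedron v) {s : Finset (Fin 5)} (hs : s.card ≤ 3) :
    AffineIndependent ℝ ((↑) : s.map v → E3) := by
  have h : AffineIndependent ℝ (fun i : s => v i) := by
    rw [affineIndependent_iff_of_fintype]
    intro w hw hw'
    rw [Finset.weightedVSub_eq_linear_combination Finset.univ hw] at hw'
    have hc : ∀ i : s, Function.extend Subtype.val w 0 (i : Fin 5) = w i :=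
      fun i => Subtype.val_injective.extend_apply w 0 i
    have hc' : ∀ i ∉ s, Function.extend Subtype.val w 0 i = 0 := fun i hi =>
      Function.extend_apply' _ _ _ fun ⟨j, hj⟩ => hi (hj ▸ j.2)
    obtain ⟨κ, hκ⟩ := hv (Function.extend Subtype.val w 0)
      (by
        rw [← Finset.sum_subset (Finset.subset_univ s) fun i _ hi => hc' i hi,
          ← Finset.sum_coe_sort, ← hw]
        simp only [hc])
      (by
        rw [← Finset.sum_subset (Finset.subset_univ s) fun i _ hi => by rw [hc' i hi, zero_smul],
          ← Finset.sum_coe_sort, ← hw']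
        simp only [hc])
    obtain ⟨k, hk⟩ : ∃ k, k ∉ s := by
      by_contra! h
      have := (Finset.eq_univ_iff_forall.2 h) ▸ hs
      simp at this
    have hκ0 : κ = 0 := by
      have := hκ k
      rw [hc' k hk] at this
      fin_cases k <;> simpa using this.symm
    intro i
    rw [← hc i, hκ, hκ0, zero_mul]
  refine h.range.mono ?_
  rintro x hx
  obtain ⟨i, hi, rfl⟩ := Finset.mem_map.1 (Finset.mem_coe.1 hx)
  exact ⟨⟨i, hi⟩, rfl⟩

/-- Barycentric coordinates with at most three nonzero entries are unique. -/
theorem weights_eq (hv : IsCentredTetrahedron v) {s t : Finset (Fin 5)} (hs : s.card ≤ 3)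
    (ht : t.card ≤ 3) {w w' : Fin 5 → ℝ} (hw : ∀ i, 0 ≤ w i) (hw' : ∀ i, 0 ≤ w' i)
    (hws : ∀ i ∉ s, w i = 0) (hwt : ∀ i ∉ t, w' i = 0) (h1 : ∑ i, w i = ∑ i, w' i)
    (hx : ∑ i, w i • v i = ∑ i, w' i • v i) : w = w' := by
  obtain ⟨κ, hκ⟩ := hv (w - w') (by simp [h1]) (by simp [sub_smul, hx])
  -- a nonzero multiple of the relation would make four weights of one side positive
  have key : ∀ s : Finset (Fin 5), s.card ≤ 3 → ∃ i ∉ s, i ≠ 2 := by decide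
  have hd : ∀ i : Fin 5, i ≠ 2 → (![1, 1, -4, 1, 1] : Fin 5 → ℝ) i = 1 := by
    intro i hi
    fin_cases i <;> simp at hi ⊢
  obtain ⟨i, his, hi⟩ := key s hs
  obtain ⟨j, hjt, hj⟩ := key t ht
  have hi' := hκ i
  have hj' := hκ j
  simp only [Pi.sub_apply, hd i hi, hd j hj, hws i his, hwt j hjt] at hi' hj'
  have hκ0 : κ = 0 := le_antisymm (by linarith [hw' i]) (by linarith [hw j])
  funext k
  have := hκ k
  rw [hκ0, zero_mul, Pi.sub_apply] at this
  linarith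

theorem inter_subset (hv : IsCentredTetrahedron v) {s t : Finset (Fin 5)} (hs : s.card ≤ 3)
    (ht : t.card ≤ 3) :
    convexHull ℝ (s.map v : Set E3) ∩ convexHull ℝ (t.map v : Set E3) ⊆
      convexHull ℝ ((s.map v : Set E3) ∩ (t.map v : Set E3)) := by
  rintro x ⟨hxs, hxt⟩
  obtain ⟨w, h0, hws, h1, hx⟩ := mem_convexHull_map.1 hxs
  obtain ⟨w', h0', hwt, h1', hx'⟩ := mem_convexHull_map.1 hxt
  have hww := hv.weights_eq hs ht h0 h0' hws hwt (h1.trans h1'.symm) (hx.trans hx'.symm)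
  rw [← Finset.coe_inter, ← Finset.map_inter]
  refine mem_convexHull_map.2 ⟨w, h0, fun i hi => ?_, h1, hx⟩
  rw [Finset.mem_inter, not_and_or] at hi
  exact hi.elim (hws i) fun h => hww ▸ hwt i h

end IsCentredTetrahedron

/-- The five-vertex Möbius band on the vertices and the barycentre of a tetrahedron. -/
def moebius (v : Fin 5 ↪ E3) (hv : IsCentredTetrahedron v) : SimplicialComplex ℝ E3 where
  faces := (fun s : Finset (Fin 5) => s.map v) '' moebiusFaces
  isRelLowerSet_faces := by
    rintro _ ⟨s, hs, rfl⟩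
    have hs' := hs
    simp only [moebiusFaces, Finset.coe_filter, Finset.mem_univ, true_and, mem_ofPred_eq] at hs'
    refine ⟨hs'.1.map, fun t hts htn => ?_⟩
    obtain ⟨u, hus, rfl⟩ := Finset.subset_map_iff.1 hts
    refine ⟨u, ?_, rfl⟩
    simp only [moebiusFaces, Finset.coe_filter, Finset.mem_univ, true_and, mem_ofPred_eq]
    obtain ⟨j, hj⟩ := hs'.2
    exact ⟨Finset.map_nonempty.1 htn, j, hus.trans hj⟩
  indep := by
    rintro _ ⟨s, hs, rfl⟩
    exact hv.indep (card_le_of_mem_moebiusFaces hs)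
  inter_subset_convexHull := by
    rintro _ _ ⟨s, hs, rfl⟩ ⟨t, ht, rfl⟩
    exact hv.inter_subset (card_le_of_mem_moebiusFaces hs) (card_le_of_mem_moebiusFaces ht)

section

variable {v : Fin 5 ↪ E3} {hv : IsCentredTetrahedron v}

theorem map_mem_moebius {s : Finset (Fin 5)} :
    s.map v ∈ (moebius v hv).faces ↔ s ∈ moebiusFaces :=
  (Finset.map_injective v).mem_set_image

theorem pair_mem_moebius {i j : Fin 5} :
    ({v i, v j} : Finset E3) ∈ (moebius v hv).faces ↔ {i, j} ∈ moebiusFaces := by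
  rw [← map_mem_moebius (v := v) (hv := hv), Finset.map_insert, Finset.map_singleton]

theorem triple_mem_moebius {i j k : Fin 5} :
    ({v i, v j, v k} : Finset E3) ∈ (moebius v hv).faces ↔ {i, j, k} ∈ moebiusFaces := by
  rw [← map_mem_moebius (v := v) (hv := hv), Finset.map_insert, Finset.map_insert,
    Finset.map_singleton]

theorem facesOfCard_moebius (k : ℕ) : facesOfCard (moebius v hv) k =
    (fun s : Finset (Fin 5) => s.map v) ''
      (({s ∈ moebiusFaces | s.card = k} : Finset (Finset (Fin 5))) : Set (Finset (Fin 5))) := by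
  ext t
  constructor
  · rintro ⟨⟨s, hs, rfl⟩, hc⟩
    rw [Finset.card_map] at hc
    exact ⟨s, by simpa using ⟨hs, hc⟩, rfl⟩
  · rintro ⟨s, hs, rfl⟩
    rw [Finset.mem_coe, Finset.mem_filter] at hs
    exact ⟨⟨s, hs.1, rfl⟩, (Finset.card_map v).trans hs.2⟩

theorem trianglesAt_moebius (e : Finset (Fin 5)) : trianglesAt (moebius v hv) (e.map v) =
    (fun s : Finset (Fin 5) => s.map v) ''
      (({s ∈ moebiusFaces | s.card = 3 ∧ e ⊆ s} : Finset (Finset (Fin 5))) :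
        Set (Finset (Fin 5))) := by
  ext t
  simp only [trianglesAt, facesOfCard_moebius]
  constructor
  · rintro ⟨⟨s, hs, rfl⟩, hc⟩
    have hc := Finset.map_subset_map.1 hc
    rw [Finset.mem_coe, Finset.mem_filter] at hs
    exact ⟨s, by simpa using ⟨hs.1, hs.2, hc⟩, rfl⟩
  · rintro ⟨s, hs, rfl⟩
    rw [Finset.mem_coe, Finset.mem_filter] at hs
    exact ⟨⟨s, by simpa using ⟨hs.1, hs.2.1⟩, rfl⟩, Finset.map_subset_map.2 hs.2.2⟩

theorem ncard_facesOfCard_moebius (k : ℕ) : (facesOfCard (moebius v hv) k).ncard =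
    {s ∈ moebiusFaces | s.card = k}.card := by
  rw [facesOfCard_moebius, Set.ncard_image_of_injective _ (Finset.map_injective v),
    Set.ncard_coe_finset]

theorem ncard_trianglesAt_moebius (e : Finset (Fin 5)) :
    (trianglesAt (moebius v hv) (e.map v)).ncard =
      {s ∈ moebiusFaces | s.card = 3 ∧ e ⊆ s}.card := by
  rw [trianglesAt_moebius, Set.ncard_image_of_injective _ (Finset.map_injective v),
    Set.ncard_coe_finset]

theorem eulerChar_moebius : eulerChar (moebius v hv) = 0 := by
  simp only [eulerChar, ncard_facesOfCard_moebius]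
  decide

/-- The boundary of the five-vertex Möbius band is the pentagon with the edges `{j, j + 1}`. -/
theorem boundaryEdges_moebius : boundaryEdges (moebius v hv) =
    range fun j : Fin 5 => ({v j, v (j + 1)} : Finset E3) := by
  have key : ∀ s : Finset (Fin 5), (s ∈ moebiusFaces ∧ s.card = 2) ∧
      {t ∈ moebiusFaces | t.card = 3 ∧ s ⊆ t}.card = 1 ↔ ∃ j, {j, j + 1} = s := by decide
  ext t
  constructor
  · rintro ⟨⟨⟨s, hs, rfl⟩, hc⟩, h1⟩
    rw [Finset.card_map] at hc
    simp only [ncard_trianglesAt_moebius] at h1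
    obtain ⟨j, rfl⟩ := (key s).1 ⟨⟨hs, hc⟩, h1⟩
    exact ⟨j, by simp [Finset.map_insert]⟩
  · rintro ⟨j, rfl⟩
    obtain ⟨⟨h1, h2⟩, h3⟩ := (key {j, j + 1}).2 ⟨j, rfl⟩
    have : ({v j, v (j + 1)} : Finset E3) = ({j, j + 1} : Finset (Fin 5)).map v := by
      simp [Finset.map_insert]
    dsimp only
    rw [this]
    exact ⟨⟨map_mem_moebius.2 h1, (Finset.card_map v).trans h2⟩,
      (ncard_trianglesAt_moebius _).trans h3⟩

/-- The link of the vertex `i` is the path through `i + 1`, `i + 3`, `i + 2`, `i + 4`. -/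
theorem vertexLink_moebius_connected (i : Fin 5) :
    (vertexLink (moebius v hv) (v i)).Connected := by
  have hne : ∀ j, j ≠ i → {i, j} ∈ moebiusFaces := by
    revert i
    decide
  let n : ∀ j, j ≠ i → {w : E3 // w ≠ v i ∧ ({v i, w} : Finset E3) ∈ (moebius v hv).faces} :=
    fun j hj => ⟨v j, v.injective.ne hj, pair_mem_moebius.2 (hne j hj)⟩
  have adj : ∀ j k (hj : j ≠ i) (hk : k ≠ i), j ≠ k → {i, j, k} ∈ moebiusFaces →
      (vertexLink (moebius v hv) (v i)).Reachable (n j hj) (n k hk) := fun j k hj hk hjk h =>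
    SimpleGraph.Adj.reachable ⟨fun hc => hjk (v.injective (Subtype.mk.inj hc)),
      triple_mem_moebius.2 h⟩
  have ne : ∀ i : Fin 5, i + 1 ≠ i ∧ i + 2 ≠ i ∧ i + 3 ≠ i ∧ i + 4 ≠ i := by decide
  have tri : ∀ i : Fin 5, {i, i + 1, i + 3} ∈ moebiusFaces ∧ {i, i + 3, i + 2} ∈ moebiusFaces ∧
      {i, i + 2, i + 4} ∈ moebiusFaces := by decide
  have ne' : ∀ i : Fin 5, i + 1 ≠ i + 3 ∧ i + 3 ≠ i + 2 ∧ i + 2 ≠ i + 4 := by decide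
  have cases : ∀ i j : Fin 5, j ≠ i → j = i + 1 ∨ j = i + 2 ∨ j = i + 3 ∨ j = i + 4 := by decide
  obtain ⟨ne1, ne2, ne3, ne4⟩ := ne i
  have r13 := adj (i + 1) (i + 3) ne1 ne3 (ne' i).1 (tri i).1
  have r32 := adj (i + 3) (i + 2) ne3 ne2 (ne' i).2.1 (tri i).2.1
  have r24 := adj (i + 2) (i + 4) ne2 ne4 (ne' i).2.2 (tri i).2.2
  have key : ∀ w, (vertexLink (moebius v hv) (v i)).Reachable (n (i + 1) ne1) w := by
    rintro ⟨w, hw, hwf⟩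
    obtain ⟨j, rfl⟩ : ∃ j, v j = w := by
      obtain ⟨s, -, hs⟩ := hwf
      have : w ∈ s.map v := by
        dsimp only at hs
        simp [hs]
      obtain ⟨j, -, hj⟩ := Finset.mem_map.1 this
      exact ⟨j, hj⟩
    have hji : j ≠ i := fun h => hw (h ▸ rfl)
    rcases cases i j hji with rfl | rfl | rfl | rfl
    · rfl
    · exact r13.trans r32
    · exact r13
    · exact (r13.trans r32).trans r24
  exact (SimpleGraph.connected_iff _).2 ⟨fun x y => (key x).symm.trans (key y), ⟨n _ ne1⟩⟩

theorem isSurface_moebius : IsSurface (moebius v hv) where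
  finite := (Finset.finite_toSet _).image _
  pure := by
    rintro _ ⟨s, hs, rfl⟩
    have key : ∀ s ∈ moebiusFaces, ∃ t ∈ moebiusFaces, t.card = 3 ∧ s ⊆ t := by decide
    obtain ⟨t, ht, hc, hst⟩ := key s hs
    exact ⟨t.map v, ⟨map_mem_moebius.2 ht, (Finset.card_map v).trans hc⟩,
      Finset.map_subset_map.2 hst⟩
  card_le := by
    rintro _ ⟨s, hs, rfl⟩
    exact (Finset.card_map v).trans_le (card_le_of_mem_moebiusFaces hs)
  edge := by
    rintro _ ⟨⟨s, hs, rfl⟩, hc⟩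
    have key : ∀ s ∈ moebiusFaces, s.card = 2 →
      {t ∈ moebiusFaces | t.card = 3 ∧ s ⊆ t}.card ≤ 2 := by decide
    rw [Finset.card_map] at hc
    exact (ncard_trianglesAt_moebius s).trans_le (key s hs hc)
  link_connected := by
    rintro x ⟨s, -, hs⟩
    have : x ∈ s.map v := by
      dsimp only at hs
      simp [hs]
    obtain ⟨i, -, rfl⟩ := Finset.mem_map.1 this
    exact vertexLink_moebius_connected i

/-- Consecutive triangles `{j, j + 1, j + 3}` and `{j + 3, j + 4, j + 1}` of the Möbius band share
the edge `{j + 1, j + 3}`, so an orientation would have to change sign an odd number (five) of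
times around the band. -/
theorem not_orientable_moebius : ¬ Orientable (moebius v hv) := by
  rintro ⟨ω, h1, h2⟩
  have tri : ∀ i j k : Fin 5, {i, j, k} ∈ moebiusFaces → ({i, j, k} : Finset (Fin 5)).card = 3 →
      ({v i, v j, v k} : Finset E3) ∈ facesOfCard (moebius v hv) 3 := by
    intro i j k h hc
    refine ⟨triple_mem_moebius.2 h, ?_⟩
    have := (Finset.card_map v).trans hc
    rwa [Finset.map_insert, Finset.map_insert, Finset.map_singleton] at this
  have key : ∀ j : Fin 5,
      ({j, j + 1, j + 3} ∈ moebiusFaces ∧ ({j, j + 1, j + 3} : Finset (Fin 5)).card = 3) ∧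
      ({j + 1, j + 3, j} ∈ moebiusFaces ∧ ({j + 1, j + 3, j} : Finset (Fin 5)).card = 3) ∧
      ({j + 1, j + 3, j + 4} ∈ moebiusFaces ∧
        ({j + 1, j + 3, j + 4} : Finset (Fin 5)).card = 3) ∧ j ≠ j + 4 := by decide
  have flip : ∀ j : Fin 5, ω (v (j + 3)) (v (j + 4)) (v (j + 1)) =
      -ω (v j) (v (j + 1)) (v (j + 3)) := by
    intro j
    have t1 := tri j (j + 1) (j + 3) (key j).1.1 (key j).1.2
    have t2 := tri (j + 1) (j + 3) j (key j).2.1.1 (key j).2.1.2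
    have t3 := tri (j + 1) (j + 3) (j + 4) (key j).2.2.1.1 (key j).2.2.1.2
    have hne : v j ≠ v (j + 4) := v.injective.ne (key j).2.2.2
    rw [(h1 _ _ _ t3).2.2, h2 _ _ _ _ hne t2 t3, (h1 _ _ _ t1).2.2]
  -- the steps `j ↦ j + 3` visit all five triangles and return to the first one
  have f0 := flip 0
  have f3 := flip 3
  have f1 := flip 1
  have f4 := flip 4
  have f2 := flip 2
  have hpm := (h1 _ _ _ (tri 0 1 3 (by decide) (by decide))).1
  simp only [Fin.reduceAdd, zero_add, Fin.isValue] at f0 f1 f2 f3 f4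
  omega

theorem isConnected_space_moebius : IsConnected (moebius v hv).space := by
  have mem : ∀ i, v i ∈ (moebius v hv).space := fun i =>
    SimplicialComplex.subset_space
      (pair_mem_moebius.2 (by revert i; decide : {i, i} ∈ moebiusFaces)) (by simp)
  -- any two vertices are joined by an edge
  refine ⟨⟨v 0, mem 0⟩, isPreconnected_of_forall (v 0) fun y hy => ?_⟩
  obtain ⟨s, hs, hys⟩ := SimplicialComplex.mem_space_iff.1 hy
  obtain ⟨x, hx⟩ := SimplicialComplex.nonempty_of_mem_faces hs
  obtain ⟨i, rfl⟩ : ∃ i, v i = x := by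
    obtain ⟨s, -, rfl⟩ := hs
    obtain ⟨j, -, hj⟩ := Finset.mem_map.1 hx
    exact ⟨j, hj⟩
  have hedge : ({v 0, v i} : Finset E3) ∈ (moebius v hv).faces :=
    pair_mem_moebius.2 (by clear * - i; revert i; decide)
  refine ⟨convexHull ℝ (({v 0, v i} : Finset E3) : Set E3) ∪ convexHull ℝ (s : Set E3),
    union_subset (SimplicialComplex.convexHull_subset_space hedge)
      (SimplicialComplex.convexHull_subset_space hs),
    Or.inl (subset_convexHull ℝ _ (by simp)), Or.inr hys, ?_⟩
  exact IsPreconnected.union (v i) (subset_convexHull ℝ _ (by simp)) (subset_convexHull ℝ _ hx)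
    (convex_convexHull ℝ _).isPreconnected (convex_convexHull ℝ _).isPreconnected

end

end Moebius

/-! ### Lenses around an edge of a finite complex -/

section Lens

open scoped Topology

theorem exists_pos_le_norm_sub {s t : Set E3} (hs : IsCompact s) (ht : IsCompact t)
    (h : Disjoint s t) : ∃ η > 0, ∀ x ∈ s, ∀ y ∈ t, η ≤ ‖x - y‖ := by
  obtain ⟨r, hr, h⟩ := Metric.exists_pos_forall_lt_edist hs ht.isClosed h
  refine ⟨r, hr, fun x hx y hy => ?_⟩
  have := h x hx y hy
  rw [edist_nndist, ENNReal.coe_lt_coe] at this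
  rw [← dist_eq_norm]
  exact (NNReal.coe_lt_coe.2 this).le

theorem isCompact_convexHull_finset (s : Finset E3) : IsCompact (convexHull ℝ (s : Set E3)) :=
  s.finite_toSet.isCompact_convexHull ℝ

/-- A simplex that meets the edge `[a, b]` only in `a` recedes from the edge at least linearly. -/
theorem exists_pos_mul_le_norm_of_mem {K : SimplicialComplex ℝ E3} {a b : E3}
    (hab : ({a, b} : Finset E3) ∈ K.faces) {s : Finset E3} (hs : s ∈ K.faces) (ha : a ∈ s)
    (hb : b ∉ s) : ∃ η > 0, ∀ x ∈ convexHull ℝ (s : Set E3), ∀ r ∈ Icc (0 : ℝ) 1,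
      η * r ≤ ‖x - (a + r • (b - a))‖ := by
  have hbv : b ∈ K.vertices := K.down_closed hab (by simp) (Finset.singleton_nonempty b)
  have hbs : b ∉ convexHull ℝ (s : Set E3) := fun h =>
    hb ((SimplicialComplex.vertex_mem_convexHull_iff hbv hs).1 h)
  obtain ⟨η₂, hη₂, h₂⟩ := exists_pos_le_norm_sub (isCompact_convexHull_finset s)
    (isCompact_singleton (x := b)) (disjoint_singleton_right.2 hbs)
  have hsa : insert a (s.erase a : Set E3) = (s : Set E3) := by
    rw [← Finset.coe_insert, Finset.insert_erase ha]
  rcases (s.erase a).eq_empty_or_nonempty with h0 | hne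
  · rw [h0, Finset.coe_empty, insert_empty_eq] at hsa
    refine ⟨‖b - a‖, norm_pos_iff.2 (sub_ne_zero.2 fun h => hb (h ▸ ha)), fun x hx r hr => ?_⟩
    rw [← hsa, convexHull_singleton, mem_singleton_iff] at hx
    rw [hx, sub_add_cancel_left, norm_neg, norm_smul, Real.norm_of_nonneg hr.1, mul_comm]
  have hs' : s.erase a ∈ K.faces := K.down_closed hs (s.erase_subset a) hne
  have hdisj : Disjoint (convexHull ℝ (s.erase a : Set E3))
      (convexHull ℝ (({a, b} : Finset E3) : Set E3)) := by
    rw [Set.disjoint_iff]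
    refine (K.inter_subset_convexHull hs' hab).trans ?_
    have : ((s.erase a : Finset E3) : Set E3) ∩ (({a, b} : Finset E3) : Set E3) = ∅ := by
      ext x
      simp only [Finset.coe_erase, Finset.coe_pair, mem_inter_iff, mem_sdiff, Finset.mem_coe,
        mem_singleton_iff, mem_insert_iff, mem_empty_iff_false, iff_false]
      rintro ⟨⟨h1, h2⟩, h3 | h3⟩
      exacts [h2 h3, hb (h3 ▸ h1)]
    rw [this, convexHull_empty]
  obtain ⟨η₁, hη₁, h₁⟩ := exists_pos_le_norm_sub (isCompact_convexHull_finset _)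
    (isCompact_convexHull_finset _) hdisj
  refine ⟨min η₁ η₂, lt_min hη₁ hη₂, fun x hx r hr => ?_⟩
  rw [← hsa, convexHull_insert (Finset.coe_nonempty.2 hne), mem_convexJoin] at hx
  obtain ⟨a', ha', y, hy, hx⟩ := hx
  rw [mem_singleton_iff.1 ha'] at hx
  rw [segment_eq_image'] at hx
  obtain ⟨q, hq, rfl⟩ := hx
  have hys : segment ℝ a y ⊆ convexHull ℝ (s : Set E3) :=
    (convex_convexHull ℝ _).segment_subset (subset_convexHull ℝ _ ha)
      (convexHull_mono (Finset.coe_subset.2 (s.erase_subset a)) hy)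
  rcases le_or_gt r q with hrq | hrq
  · -- rescale so that the point of the simplex lies on the face opposite to `a`
    rcases hq.1.eq_or_lt with hq0 | hq0
    · have : r = 0 := le_antisymm (hrq.trans hq0.ge) hr.1
      simp [this]
    have hz : a + (r / q) • (b - a) ∈ convexHull ℝ (({a, b} : Finset E3) : Set E3) := by
      rw [Finset.coe_pair, convexHull_pair, segment_eq_image']
      exact ⟨r / q, ⟨div_nonneg hr.1 hq0.le, (div_le_one hq0).2 hrq⟩, rfl⟩
    have heq : a + q • (y - a) - (a + r • (b - a)) = q • (y - (a + (r / q) • (b - a))) := by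
      have h : q • (r / q) • (b - a) = r • (b - a) := by rw [smul_smul, mul_div_cancel₀ _ hq0.ne']
      linear_combination (norm := module) h
    rw [heq, norm_smul, Real.norm_of_nonneg hq0.le, mul_comm]
    exact mul_le_mul hrq ((min_le_left _ _).trans (h₁ y hy _ hz)) (lt_min hη₁ hη₂).le hq0.le
  · -- rescale so that the point of the edge is `b`
    have hr0 : 0 < r := hq.1.trans_lt hrq
    have hz : a + (q / r) • (y - a) ∈ convexHull ℝ (s : Set E3) := by
      refine hys ?_
      rw [segment_eq_image']
      exact ⟨q / r, ⟨div_nonneg hq.1 hr0.le, (div_le_one hr0).2 hrq.le⟩, rfl⟩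
    have heq : a + q • (y - a) - (a + r • (b - a)) = r • (a + (q / r) • (y - a) - b) := by
      have h : r • (q / r) • (y - a) = q • (y - a) := by rw [smul_smul, mul_div_cancel₀ _ hr0.ne']
      linear_combination (norm := module) (-1 : ℝ) • h
    rw [heq, norm_smul, Real.norm_of_nonneg hr0.le, mul_comm]
    exact mul_le_mul_of_nonneg_left ((min_le_right _ _).trans (h₂ _ hz b rfl)) hr0.le

/-- A simplex that does not contain the edge `[a, b]` recedes from it at least linearly in the
distance to the nearer end point. -/
theorem exists_pos_mul_min_le_norm {K : SimplicialComplex ℝ E3} {a b : E3}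
    (hab : ({a, b} : Finset E3) ∈ K.faces) {s : Finset E3} (hs : s ∈ K.faces)
    (hne : ¬ ({a, b} : Finset E3) ⊆ s) :
    ∃ η > 0, ∀ x ∈ convexHull ℝ (s : Set E3), ∀ r ∈ Icc (0 : ℝ) 1,
      η * min r (1 - r) ≤ ‖x - (a + r • (b - a))‖ := by
  by_cases ha : a ∈ s
  · have hb : b ∉ s := fun hb => hne (by simp [Finset.insert_subset_iff, ha, hb])
    obtain ⟨η, hη, h⟩ := exists_pos_mul_le_norm_of_mem hab hs ha hb
    exact ⟨η, hη, fun x hx r hr =>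
      (mul_le_mul_of_nonneg_left (min_le_left _ _) hη.le).trans (h x hx r hr)⟩
  by_cases hb : b ∈ s
  · obtain ⟨η, hη, h⟩ := exists_pos_mul_le_norm_of_mem (Finset.pair_comm a b ▸ hab) hs hb ha
    refine ⟨η, hη, fun x hx r hr => ?_⟩
    have := h x hx (1 - r) ⟨by linarith [hr.2], by linarith [hr.1]⟩
    have heq : b + (1 - r) • (a - b) = a + r • (b - a) := by module
    rw [heq] at this
    exact (mul_le_mul_of_nonneg_left (min_le_right _ _) hη.le).trans this
  have hdisj : Disjoint (convexHull ℝ (s : Set E3))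
      (convexHull ℝ (({a, b} : Finset E3) : Set E3)) := by
    rw [Set.disjoint_iff]
    refine (K.inter_subset_convexHull hs hab).trans ?_
    have : (s : Set E3) ∩ (({a, b} : Finset E3) : Set E3) = ∅ := by
      ext x
      simp only [Finset.coe_pair, mem_inter_iff, Finset.mem_coe, mem_singleton_iff,
        mem_insert_iff, mem_empty_iff_false, iff_false]
      rintro ⟨h1, h3 | h3⟩
      exacts [ha (h3 ▸ h1), hb (h3 ▸ h1)]
    rw [this, convexHull_empty]
  obtain ⟨η, hη, h⟩ := exists_pos_le_norm_sub (isCompact_convexHull_finset s)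
    (isCompact_convexHull_finset _) hdisj
  refine ⟨η, hη, fun x hx r hr => ?_⟩
  have hm : min r (1 - r) ≤ 1 := (min_le_left _ _).trans hr.2
  refine (mul_le_of_le_one_right hη.le hm).trans (h x hx _ ?_)
  rw [Finset.coe_pair, convexHull_pair, segment_eq_image']
  exact ⟨r, hr, rfl⟩

/-- In a finite complex the estimate of `exists_pos_mul_min_le_norm` holds with one constant for
all simplices that do not contain the edge. -/
theorem exists_pos_forall_mul_min_le_norm {K : SimplicialComplex ℝ E3} (hK : K.faces.Finite)
    {a b : E3} (hab : ({a, b} : Finset E3) ∈ K.faces) :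
    ∃ η > 0, ∀ s ∈ K.faces, ¬ ({a, b} : Finset E3) ⊆ s → ∀ x ∈ convexHull ℝ (s : Set E3),
      ∀ r ∈ Icc (0 : ℝ) 1, η * min r (1 - r) ≤ ‖x - (a + r • (b - a))‖ := by
  have key : ∀ᶠ η in 𝓝[>] (0 : ℝ), ∀ s ∈ K.faces, ¬ ({a, b} : Finset E3) ⊆ s →
      ∀ x ∈ convexHull ℝ (s : Set E3), ∀ r ∈ Icc (0 : ℝ) 1,
        η * min r (1 - r) ≤ ‖x - (a + r • (b - a))‖ := by
    rw [Filter.eventually_all_finite hK]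
    intro s hs
    by_cases hne : ({a, b} : Finset E3) ⊆ s
    · exact Filter.Eventually.of_forall fun _ h => absurd hne h
    obtain ⟨η₀, hη₀, h⟩ := exists_pos_mul_min_le_norm hab hs hne
    filter_upwards [Ioo_mem_nhdsGT hη₀] with η hη _ x hx r hr
    refine (mul_le_mul_of_nonneg_right hη.2.le ?_).trans (h x hx r hr)
    exact le_min hr.1 (sub_nonneg.2 hr.2)
  obtain ⟨η, hη, h⟩ := ((eventually_mem_nhdsWithin (s := Ioi (0 : ℝ))).and key).exists
  exact ⟨η, hη, h⟩

/-- A lens-shaped neighbourhood of the open segment from `a` to `b`, where `f (b - a) = 1`: a point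
of height `s = f (x - a)` has distance at most `η * min s (1 - s)` from the point `a + s (b - a)`
of the same height. -/
def lens (a b : E3) (f : E3 →L[ℝ] ℝ) (η : ℝ) : Set E3 :=
  {x | ‖x - a - f (x - a) • (b - a)‖ ≤ η * min (f (x - a)) (1 - f (x - a))}

variable {a b x : E3} {f : E3 →L[ℝ] ℝ} {η : ℝ}

theorem mem_lens (hη : 0 < η) : x ∈ lens a b f η ↔
    ‖x - a - f (x - a) • (b - a)‖ ≤ η * f (x - a) ∧
      ‖x - a - f (x - a) • (b - a)‖ ≤ η * (1 - f (x - a)) := by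
  rw [lens, mem_ofPred_eq, mul_min_of_nonneg _ _ hη.le, le_min_iff]

theorem height_mem_Icc_of_mem_lens (hη : 0 < η) (hx : x ∈ lens a b f η) :
    f (x - a) ∈ Icc (0 : ℝ) 1 := by
  obtain ⟨h1, h2⟩ := (mem_lens hη).1 hx
  exact ⟨nonneg_of_mul_nonneg_right ((norm_nonneg _).trans h1) hη,
    sub_nonneg.1 (nonneg_of_mul_nonneg_right ((norm_nonneg _).trans h2) hη)⟩

theorem convex_lens (hη : 0 < η) : Convex ℝ (lens a b f η) := by
  intro x hx y hy p q hp hq hpq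
  rw [mem_lens hη] at hx hy ⊢
  have hsub : p • x + q • y - a = p • (x - a) + q • (y - a) := by
    have : a = (p + q) • a := by rw [hpq, one_smul]
    nth_rewrite 1 [this]
    module
  have hf : f (p • x + q • y - a) = p * f (x - a) + q * f (y - a) := by
    rw [hsub, map_add, map_smul, map_smul, smul_eq_mul, smul_eq_mul]
  have hn : ‖p • x + q • y - a - f (p • x + q • y - a) • (b - a)‖ ≤
      p * ‖x - a - f (x - a) • (b - a)‖ + q * ‖y - a - f (y - a) • (b - a)‖ := by
    have : p • x + q • y - a - f (p • x + q • y - a) • (b - a) =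
        p • (x - a - f (x - a) • (b - a)) + q • (y - a - f (y - a) • (b - a)) := by
      rw [hf, hsub]
      module
    rw [this]
    refine (norm_add_le _ _).trans ?_
    rw [norm_smul, norm_smul, Real.norm_of_nonneg hp, Real.norm_of_nonneg hq]
  have e1 := mul_le_mul_of_nonneg_left hx.1 hp
  have e2 := mul_le_mul_of_nonneg_left hy.1 hq
  have e3 := mul_le_mul_of_nonneg_left hx.2 hp
  have e4 := mul_le_mul_of_nonneg_left hy.2 hq
  rw [hf] at hn ⊢
  constructor
  · linarith
  · have : η * (1 - (p * f (x - a) + q * f (y - a))) =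
        p * (η * (1 - f (x - a))) + q * (η * (1 - f (y - a))) := by
      linear_combination (-η) * hpq
    linarith

theorem isClosed_lens : IsClosed (lens a b f η) :=
  isClosed_le (by fun_prop) (by fun_prop)

theorem isBounded_lens (hη : 0 < η) : Bornology.IsBounded (lens a b f η) := by
  refine (Metric.isBounded_closedBall (x := a) (r := η + ‖b - a‖)).subset fun x hx => ?_
  have hs := height_mem_Icc_of_mem_lens hη hx
  have h1 := ((mem_lens hη).1 hx).1
  rw [mem_closedBall_iff_norm]
  have h2 := norm_add_le (x - a - f (x - a) • (b - a)) (f (x - a) • (b - a))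
  rw [sub_add_cancel, norm_smul, Real.norm_of_nonneg hs.1] at h2
  have h3 : η * f (x - a) ≤ η := mul_le_of_le_one_right hη.le hs.2
  have h4 : f (x - a) * ‖b - a‖ ≤ ‖b - a‖ := mul_le_of_le_one_left (norm_nonneg _) hs.2
  linarith

theorem mem_interior_lens
    (hx : ‖x - a - f (x - a) • (b - a)‖ < η * min (f (x - a)) (1 - f (x - a))) :
    x ∈ interior (lens a b f η) := by
  refine interior_maximal (t := {x | ‖x - a - f (x - a) • (b - a)‖ <
    η * min (f (x - a)) (1 - f (x - a))}) (Set.ofPred_subset_ofPred.2 fun y => le_of_lt) ?_ hx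
  exact isOpen_lt (by fun_prop) (by fun_prop)

theorem height_mem_Ioo_of_mem_interior_lens (hf : f (b - a) = 1) (hη : 0 < η)
    (hx : x ∈ interior (lens a b f η)) : f (x - a) ∈ Ioo (0 : ℝ) 1 := by
  have hf0 : f ≠ 0 := by
    rintro rfl
    simp at hf
  have hsub : f '' interior (lens a b f η) ⊆ interior (Icc (f a) (f a + 1)) := by
    refine interior_maximal (image_subset_iff.2 fun v hv => ?_)
      (f.isOpenMap_of_ne_zero hf0 _ isOpen_interior)
    have := height_mem_Icc_of_mem_lens hη (interior_subset hv)
    rw [map_sub, mem_Icc] at this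
    exact ⟨by linarith [this.1], by linarith [this.2]⟩
  have := hsub (mem_image_of_mem f hx)
  rw [interior_Icc, mem_Ioo] at this
  rw [map_sub]
  exact ⟨by linarith [this.1], by linarith [this.2]⟩

theorem left_mem_frontier_lens (hf : f (b - a) = 1) (hη : 0 < η) :
    a ∈ frontier (lens a b f η) := by
  refine ⟨subset_closure (by simp [lens]), fun h => ?_⟩
  have := (height_mem_Ioo_of_mem_interior_lens hf hη h).1
  simp at this

theorem right_mem_frontier_lens (hf : f (b - a) = 1) (hη : 0 < η) :
    b ∈ frontier (lens a b f η) := by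
  refine ⟨subset_closure ((mem_lens hη).2 (by simp [hf, -map_sub, hη.le])), fun h => ?_⟩
  have := (height_mem_Ioo_of_mem_interior_lens hf hη h).2
  simp [hf] at this

theorem midpoint_mem_interior_lens (hf : f (b - a) = 1) (hη : 0 < η) :
    midpoint ℝ a b ∈ interior (lens a b f η) := by
  have h : midpoint ℝ a b - a = (1 / 2 : ℝ) • (b - a) := by
    rw [midpoint_eq_smul_add, invOf_eq_inv]
    module
  apply mem_interior_lens
  rw [h, map_smul, hf, smul_eq_mul, mul_one, sub_self, norm_zero]
  norm_num
  exact hη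

/-- A sufficiently thin lens around an edge of a finite complex meets the simplices that do not
contain the edge only in its end points. -/
theorem exists_lens_inter_subset {K : SimplicialComplex ℝ E3} (hK : K.faces.Finite)
    {a b : E3} (hab : ({a, b} : Finset E3) ∈ K.faces) :
    ∃ η > 0, ∀ f : E3 →L[ℝ] ℝ, ∀ s ∈ K.faces, ¬ ({a, b} : Finset E3) ⊆ s →
      convexHull ℝ (s : Set E3) ∩ lens a b f η ⊆ {a, b} := by
  obtain ⟨η, hη, h⟩ := exists_pos_forall_mul_min_le_norm hK hab
  refine ⟨η / 2, half_pos hη, fun f s hs hne x ⟨hxs, hx⟩ => ?_⟩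
  have hr := height_mem_Icc_of_mem_lens (half_pos hη) hx
  have h1 := h s hs hne x hxs _ hr
  have h2 : ‖x - a - f (x - a) • (b - a)‖ ≤ η / 2 * min (f (x - a)) (1 - f (x - a)) := hx
  rw [← sub_sub] at h1
  have h3 : 0 ≤ min (f (x - a)) (1 - f (x - a)) := le_min hr.1 (sub_nonneg.2 hr.2)
  have h4 : η * min (f (x - a)) (1 - f (x - a)) ≤ 0 := by linarith
  have h5 : min (f (x - a)) (1 - f (x - a)) = 0 :=
    le_antisymm (nonpos_of_mul_nonpos_right h4 hη) h3
  rw [h5, mul_zero, norm_le_zero_iff, sub_eq_zero] at h2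
  rcases min_choice (f (x - a)) (1 - f (x - a)) with h6 | h6
  · rw [h5] at h6
    rw [← h6, zero_smul, sub_eq_zero] at h2
    exact Or.inl h2
  · have h7 : f (x - a) = 1 := by linarith
    rw [h7, one_smul, sub_left_inj] at h2
    exact Or.inr h2

end Lens

/-! ### Attaching a Möbius band to a surface -/

section Crosscap

theorem linearIndependent_sub_of_affineIndependent {a b c : E3}
    (h : AffineIndependent ℝ ![a, b, c]) : LinearIndependent ℝ ![b - a, c - a] := by
  rw [affineIndependent_iff] at h
  rw [LinearIndependent.pair_iff]
  intro s t hst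
  have key := h Finset.univ ![-s - t, s, t] (by simp [Fin.sum_univ_three]; ring)
    (by
      simp only [Fin.sum_univ_three, Matrix.cons_val_zero, Matrix.cons_val_one, Matrix.cons_val]
      rw [← hst]
      module)
  exact ⟨key 1 (Finset.mem_univ _), key 2 (Finset.mem_univ _)⟩

theorem exists_basis_of_affineIndependent {a b c : E3} (h : AffineIndependent ℝ ![a, b, c]) :
    ∃ B : Module.Basis (Fin 3) ℝ E3, B 0 = b - a ∧ B 1 = c - a := by
  have hfr : Module.finrank ℝ E3 = 3 := by simp
  obtain ⟨e, he⟩ := exists_linearIndependent_snoc_of_lt_finrank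
    (linearIndependent_sub_of_affineIndependent h) (by rw [hfr]; norm_num)
  refine ⟨basisOfLinearIndependentOfCardEqFinrank he (by rw [hfr]; rfl), ?_, ?_⟩
  · rw [coe_basisOfLinearIndependentOfCardEqFinrank]
    rfl
  · rw [coe_basisOfLinearIndependentOfCardEqFinrank]
    rfl

/-- The vertices of the Möbius band that is glued to the edge `[a, b]` of a triangle `a, b, c`. The
functional `f` is the height along the edge, which increases along the boundary arc
`v 0, …, v 4` from `a` to `b`; the functional `g` separates the band from the triangle. Both are
chosen before the thickness `η` of the lens that has to contain the band. -/
theorem exists_centredTetrahedron {a b c : E3} (h : AffineIndependent ℝ ![a, b, c]) :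
    ∃ f g : E3 →L[ℝ] ℝ, f (b - a) = 1 ∧ g (b - a) = 0 ∧ g (c - a) = 1 ∧ ∀ η > 0,
      ∃ v : Fin 5 ↪ E3, IsCentredTetrahedron v ∧ v 0 = a ∧ v 4 = b ∧ StrictMono (f ∘ v) ∧
        (∀ i, g (v i - a) ≤ 0) ∧ ∀ i, i ≠ 0 → i ≠ 4 → v i ∈ interior (lens a b f η) := by
  obtain ⟨B, hB0, hB1⟩ := exists_basis_of_affineIndependent h
  let f : E3 →L[ℝ] ℝ := LinearMap.toContinuousLinearMap (B.coord 0)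
  let g : E3 →L[ℝ] ℝ := LinearMap.toContinuousLinearMap (B.coord 1)
  have hf : ∀ x y z : ℝ, f (x • B 0 + y • B 1 + z • B 2) = x := fun x y z => by
    simp [f]
  have hg : ∀ x y z : ℝ, g (x • B 0 + y • B 1 + z • B 2) = y := fun x y z => by
    simp [g]
  have hk : ∀ x y z : ℝ, B.coord 2 (x • B 0 + y • B 1 + z • B 2) = z := fun x y z => by
    simp
  refine ⟨f, g, ?_, ?_, ?_, fun η hη => ?_⟩
  · simpa [hB0] using hf 1 0 0
  · simpa [hB0] using hg 1 0 0
  · simpa [hB1] using hg 0 1 0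
  obtain ⟨δ, hδ, hδη⟩ : ∃ δ > 0, δ * (‖B 1‖ + ‖B 2‖) < η / 3 := by
    refine ⟨η / 3 / (‖B 1‖ + ‖B 2‖ + 1), by positivity, ?_⟩
    rw [div_mul_eq_mul_div, div_lt_iff₀ (by positivity)]
    have : 0 < η / 3 := by positivity
    linarith
  -- the coordinates of the vertices: the middle one is the mean of the other four, and the
  -- bound on `δ` keeps the inner vertices, whose heights are in `[1 / 3, 2 / 3]`, inside the lens
  let X : Fin 5 → ℝ := ![0, 1 / 3, 1 / 2, 2 / 3, 1]
  let Y : Fin 5 → ℝ := ![0, -δ, -δ / 2, -δ, 0]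
  let Z : Fin 5 → ℝ := ![0, δ, 0, -δ, 0]
  let u : Fin 5 → E3 := fun i => X i • B 0 + Y i • B 1 + Z i • B 2
  have hX : StrictMono X := by
    intro i j hij
    fin_cases i <;> fin_cases j <;> simp [X] at hij ⊢ <;> norm_num
  have hfu : ∀ i, f (u i) = X i := fun i => hf _ _ _
  have hgu : ∀ i, g (u i) = Y i := fun i => hg _ _ _
  have hku : ∀ i, B.coord 2 (u i) = Z i := fun i => hk _ _ _
  have hfX : StrictMono (f ∘ fun i => a + u i) := fun i j hij => by
    simp only [Function.comp_apply, map_add, hfu]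
    linarith [hX hij]
  let v : Fin 5 ↪ E3 := ⟨fun i => a + u i, fun i j hij => hfX.injective (congrArg f hij)⟩
  have hvu : ∀ i, v i = a + u i := fun i => rfl
  refine ⟨v, ?_, ?_, ?_, hfX, ?_, ?_⟩
  · intro κ hκ hκu
    simp only [hvu, smul_add, Finset.sum_add_distrib, ← Finset.sum_smul,
      hκ, zero_smul, zero_add] at hκu
    have coord : ∀ (l : E3 →ₗ[ℝ] ℝ) (W : Fin 5 → ℝ), (∀ i, l (u i) = W i) →
        ∑ i, κ i * W i = 0 := fun l W hl => by
      rw [← map_zero l, ← hκu, map_sum]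
      exact Finset.sum_congr rfl fun i _ => by rw [map_smul, hl, smul_eq_mul]
    have hx := coord f X hfu
    have hy := coord g Y hgu
    have hz := coord (B.coord 2) Z hku
    simp only [Fin.sum_univ_five] at hκ hx hy hz
    simp [X, Y, Z] at hx hy hz
    have hz' : κ 1 = κ 3 := by
      have : δ * (κ 1 - κ 3) = 0 := by linarith
      rcases mul_eq_zero.1 this with h | h
      · exact absurd h hδ.ne'
      · linarith
    have hy' : κ 2 = -2 * κ 1 - 2 * κ 3 := by
      have : δ * (κ 1 + κ 2 / 2 + κ 3) = 0 := by linarith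
      rcases mul_eq_zero.1 this with h | h
      · exact absurd h hδ.ne'
      · linarith
    refine ⟨κ 1, fun i => ?_⟩
    fin_cases i <;> simp <;> linarith
  · simp [hvu, u, X, Y, Z]
  · simp [hvu, u, X, Y, Z, hB0]
  · intro i
    simp only [hvu, add_sub_cancel_left, hgu]
    fin_cases i <;> simp [Y] <;> linarith
  · intro i h0 h4
    apply mem_interior_lens
    simp only [hvu, add_sub_cancel_left, hfu]
    have e : u i - X i • (b - a) = Y i • B 1 + Z i • B 2 := by
      simp only [u, hB0]
      abel
    rw [e]
    have hY : |Y i| ≤ δ := by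
      fin_cases i <;> simp [Y, abs_of_pos hδ, hδ.le, abs_div]
    have hZ : |Z i| ≤ δ := by
      fin_cases i <;> simp [Z, abs_of_pos hδ, hδ.le]
    have hmin : 1 / 3 ≤ min (X i) (1 - X i) := by
      fin_cases i <;> simp [X] at h0 h4 ⊢ <;> norm_num
    calc ‖Y i • B 1 + Z i • B 2‖ ≤ |Y i| * ‖B 1‖ + |Z i| * ‖B 2‖ := by
          refine (norm_add_le _ _).trans ?_
          rw [norm_smul, norm_smul, Real.norm_eq_abs, Real.norm_eq_abs]
      _ ≤ δ * (‖B 1‖ + ‖B 2‖) := by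
          rw [mul_add]
          gcongr
      _ < η * (1 / 3) := by linarith
      _ ≤ η * min (X i) (1 - X i) := by gcongr

/-- A boundary edge `{a, b}` of a surface has a nondegenerate triangle `{a, b, c}` that contains
every face through the edge with at most three vertices. -/
theorem exists_triangle_of_mem_boundaryEdges {K : SimplicialComplex ℝ E3} {a b : E3}
    (hab : {a, b} ∈ boundaryEdges K) : ∃ c, a ≠ b ∧ AffineIndependent ℝ ![a, b, c] ∧
      ∀ s ∈ K.faces, s.card ≤ 3 → {a, b} ⊆ s → s ⊆ {c, a, b} := by
  obtain ⟨⟨he, hc⟩, h1⟩ := hab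
  have hne : a ≠ b := by
    rintro rfl
    simp at hc
  obtain ⟨t, ht⟩ := Set.ncard_eq_one.1 h1
  have htm : t ∈ trianglesAt K {a, b} := ht ▸ mem_singleton t
  obtain ⟨c, hcab, rfl⟩ := Finset.exists_eq_insert_iff.2 ⟨htm.2, by rw [hc, htm.1.2]⟩
  simp only [Finset.mem_insert, Finset.mem_singleton, not_or] at hcab
  refine ⟨c, hne, ?_, fun s hs hs3 hsub => ?_⟩
  · have hi := K.indep htm.1.1
    let φ : Fin 3 → ((insert c {a, b} : Finset E3) : Type) :=
      ![⟨a, by simp⟩, ⟨b, by simp⟩, ⟨c, by simp⟩]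
    have hφ : Function.Injective φ := by
      intro i j hij
      fin_cases i <;> fin_cases j <;> simp [φ, hne, hne.symm, hcab.1, hcab.2, Ne.symm hcab.1,
        Ne.symm hcab.2] at hij ⊢
    have hval : Subtype.val ∘ φ = ![a, b, c] := by
      funext i
      fin_cases i <;> rfl
    rw [← hval]
    exact hi.comp_embedding ⟨φ, hφ⟩
  · have h2 : 2 ≤ s.card := hc ▸ Finset.card_le_card hsub
    rcases h2.eq_or_lt with h2 | h2
    · rw [← Finset.eq_of_subset_of_card_le hsub (by rw [hc, ← h2])]
      exact Finset.subset_insert c {a, b}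
    · have : s ∈ trianglesAt K {a, b} := ⟨⟨hs, by omega⟩, hsub⟩
      rw [ht, mem_singleton_iff] at this
      exact this.subset

/-- A point of the triangle `a, b, c` that lies on the other side of the line through `a` and `b`
than `c`, or on the line, lies on the edge `[a, b]`. -/
theorem mem_segment_of_mem_convexHull_triple {a b c x : E3} {g : E3 →L[ℝ] ℝ}
    (hgb : g (b - a) = 0) (hgc : g (c - a) = 1)
    (hx : x ∈ convexHull ℝ (({c, a, b} : Finset E3) : Set E3)) (hgx : g (x - a) ≤ 0) :
    x ∈ segment ℝ a b := by
  rw [Finset.coe_insert, Finset.coe_pair, convexHull_insert ⟨a, by simp⟩, convexHull_pair,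
    mem_convexJoin] at hx
  obtain ⟨c', hc', y, hy, hx⟩ := hx
  rw [mem_singleton_iff.1 hc'] at hx
  obtain ⟨p, q, hp, hq, hpq, rfl⟩ := hx
  have hgy : g y = g a := by
    rw [segment_eq_image'] at hy
    obtain ⟨r, -, rfl⟩ := hy
    rw [map_add, map_smul, hgb, smul_zero, add_zero]
  rw [map_sub] at hgc
  rw [map_sub, map_add, map_smul, map_smul, hgy, smul_eq_mul, smul_eq_mul] at hgx
  have hp0 : p = 0 := by
    refine le_antisymm ?_ hp
    have : p * g c + q * g a - g a = p * (g c - g a) + (p + q - 1) * g a := by ring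
    rw [this, hgc, hpq] at hgx
    linarith
  rw [hp0, zero_add] at hpq
  rwa [hp0, hpq, zero_smul, zero_add, one_smul]

/-- Gluing a small Möbius band along a boundary edge: the Euler characteristic drops by one, the
result is not orientable, and the boundary is moved by a homeomorphism of three-space. -/
theorem exists_glue_moebius {K : SimplicialComplex ℝ E3} (hK : IsSurface K)
    (hconn : IsConnected K.space) (hne : (boundary K).Nonempty) :
    ∃ (G : SimplicialComplex ℝ E3) (Φ : E3 ≃ₜ E3), IsSurface G ∧ IsConnected G.space ∧
      ¬ Orientable G ∧ eulerChar G = eulerChar K - 1 ∧ boundary G = Φ '' boundary K := by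
  rw [boundary_eq_biUnion] at hne
  obtain ⟨x, hx⟩ := hne
  obtain ⟨e, he, -⟩ := mem_iUnion₂.1 hx
  obtain ⟨a, b, -, rfl⟩ := Finset.card_eq_two.1 he.1.2
  have habK : ({a, b} : Finset E3) ∈ K.faces := he.1.1
  obtain ⟨c, hab, hind, htri⟩ := exists_triangle_of_mem_boundaryEdges he
  obtain ⟨f, g, hfb, hgb, hgc, hv⟩ := exists_centredTetrahedron hind
  obtain ⟨η, hη, hlens⟩ := exists_lens_inter_subset hK.finite habK
  obtain ⟨v, hv, hv0, hv4, hmono, hgv, hint⟩ := hv η hη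
  have hlv : ∀ i, v i ∈ lens a b f η := by
    intro i
    by_cases h0 : i = 0
    · rw [h0, hv0]
      exact isClosed_lens.frontier_subset (left_mem_frontier_lens hfb hη)
    by_cases h4 : i = 4
    · rw [h4, hv4]
      exact isClosed_lens.frontier_subset (right_mem_frontier_lens hfb hη)
    exact interior_subset (hint i h0 h4)
  have hM : ∀ x ∈ (moebius v hv).space, x ∈ lens a b f η ∧ g (x - a) ≤ 0 := by
    intro x hx
    obtain ⟨s, ⟨t, -, rfl⟩, hxs⟩ := SimplicialComplex.mem_space_iff.1 hx
    have hsub : ∀ S : Set E3, Convex ℝ S → (∀ i, v i ∈ S) → x ∈ S := by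
      intro S hS hvS
      refine convexHull_min (fun y hy => ?_) hS hxs
      obtain ⟨i, -, rfl⟩ := Finset.mem_map.1 (Finset.mem_coe.1 hy)
      exact hvS i
    refine ⟨hsub _ (convex_lens hη) hlv, ?_⟩
    have := hsub {y | g y ≤ g a} (convex_halfSpace_le g.toLinearMap.isLinear (g a)) fun i => by
      have := hgv i
      rw [map_sub] at this
      exact sub_nonpos.1 this
    rw [map_sub]
    exact sub_nonpos.2 this
  have hmeet : K.space ∩ (moebius v hv).space ⊆ segment ℝ a b := by
    rintro x ⟨hxK, hxM⟩
    obtain ⟨s, hs, hxs⟩ := SimplicialComplex.mem_space_iff.1 hxK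
    obtain ⟨hxl, hxg⟩ := hM x hxM
    by_cases hsub : ({a, b} : Finset E3) ⊆ s
    · exact mem_segment_of_mem_convexHull_triple hgb hgc
        (convexHull_mono (Finset.coe_subset.2 (htri s hs (hK.card_le s hs) hsub)) hxs) hxg
    · rcases hlens f s hs hsub ⟨hxs, hxl⟩ with rfl | h
      · exact left_mem_segment ℝ x b
      · rw [mem_singleton_iff.1 h]
        exact right_mem_segment ℝ a b
  have heM : ({a, b} : Finset E3) ∈ boundaryEdges (moebius v hv) := by
    rw [boundaryEdges_moebius]
    refine ⟨4, ?_⟩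
    rw [← hv0, ← hv4]
    exact Finset.pair_comm _ _
  obtain ⟨G, hG⟩ := exists_isEdgeGluing hab habK heM.1.1 hmeet
  -- the part of the boundary that is kept
  let A : Set E3 := ⋃ e ∈ boundaryEdges K \ {{a, b}}, convexHull ℝ (e : Set E3)
  have hA : Disjoint A (interior (lens a b f η)) := by
    rw [Set.disjoint_left]
    intro x hxA hxl
    obtain ⟨s, ⟨hs, hne⟩, hxs⟩ := mem_iUnion₂.1 hxA
    have hsub : ¬ ({a, b} : Finset E3) ⊆ s := fun h =>
      hne (Finset.eq_of_subset_of_card_le h (by rw [hs.1.2, he.1.2])).symm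
    rcases hlens f s hs.1.1 hsub ⟨hxs, interior_subset hxl⟩ with rfl | h
    · exact (left_mem_frontier_lens hfb hη).2 hxl
    · rw [mem_singleton_iff.1 h] at hxl
      exact (right_mem_frontier_lens hfb hη).2 hxl
  have hKb : boundary K = A ∪ segment ℝ a b := by
    rw [boundary_eq_biUnion, ← Set.sdiff_union_of_subset (singleton_subset_iff.2 he),
      biUnion_union, biUnion_singleton, Finset.coe_pair, convexHull_pair]
  have hGb : boundary G = A ∪ segment ℝ a (v 1) ∪ segment ℝ (v 1) (v 2) ∪
      segment ℝ (v 2) (v 3) ∪ segment ℝ (v 3) b := by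
    have hrange : boundaryEdges (moebius v hv) \ {{a, b}} =
        ({{v 0, v 1}, {v 1, v 2}, {v 2, v 3}, {v 3, v 4}} : Set (Finset E3)) := by
      have hp : ∀ i j k l : Fin 5, ({v i, v j} : Finset E3) = {v k, v l} ↔
          ({i, j} : Finset (Fin 5)) = {k, l} := fun i j k l => by
        rw [← (Finset.map_injective v).eq_iff]
        simp only [Finset.map_insert, Finset.map_singleton]
      ext s
      rw [boundaryEdges_moebius, ← hv0, ← hv4]
      constructor
      · rintro ⟨⟨j, rfl⟩, hj⟩
        fin_cases j
        · exact Or.inl rfl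
        · exact Or.inr (Or.inl rfl)
        · exact Or.inr (Or.inr (Or.inl rfl))
        · exact Or.inr (Or.inr (Or.inr rfl))
        · exact absurd (Finset.pair_comm _ _) hj
      · rintro (rfl | rfl | rfl | rfl)
        · exact ⟨⟨0, rfl⟩, fun h => absurd ((hp _ _ _ _).1 h) (by decide)⟩
        · exact ⟨⟨1, rfl⟩, fun h => absurd ((hp _ _ _ _).1 h) (by decide)⟩
        · exact ⟨⟨2, rfl⟩, fun h => absurd ((hp _ _ _ _).1 h) (by decide)⟩
        · exact ⟨⟨3, rfl⟩, fun h => absurd ((hp _ _ _ _).1 h) (by decide)⟩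
    rw [boundary_eq_biUnion, hG.boundaryEdges_eq he heM, biUnion_union, hrange]
    simp only [biUnion_insert, biUnion_singleton, Finset.coe_pair, convexHull_pair, hv0, hv4,
      union_assoc, A]
  obtain ⟨Φ, hΦ⟩ := exists_homeomorph_segment_to_arc (convex_lens hη) isClosed_lens
    (isBounded_lens hη) f (left_mem_frontier_lens hfb hη) (right_mem_frontier_lens hfb hη)
    ⟨_, midpoint_mem_segment a b, midpoint_mem_interior_lens hfb hη⟩
    (hint 1 (by decide) (by decide)) (hint 2 (by decide) (by decide))
    (hint 3 (by decide) (by decide)) hA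
    (hv0 ▸ hmono (by decide : (0 : Fin 5) < 1)) (hmono (by decide : (1 : Fin 5) < 2))
    (hmono (by decide : (2 : Fin 5) < 3)) (hv4 ▸ hmono (by decide : (3 : Fin 5) < 4))
  refine ⟨G, Φ, hG.isSurface hK isSurface_moebius he heM,
    hG.isConnected_space hconn isConnected_space_moebius,
    fun h => not_orientable_moebius (hG.orientable_right h), ?_, ?_⟩
  · rw [hG.eulerChar_eq hK.finite isSurface_moebius.finite, eulerChar_moebius, add_zero]
  · rw [hGb, hKb, hΦ]

end Crosscap

/-! ### The genera of a link -/

section Genus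

theorem IsPolygonalKnot.nonempty {A : Set E3} (hA : IsPolygonalKnot A) : A.Nonempty := by
  obtain ⟨m, v, -, -, -, rfl⟩ := hA
  exact ⟨v 0, mem_iUnion.2 ⟨0, left_mem_segment ℝ _ _⟩⟩

theorem Link.carrier_nonempty {n : ℕ} (hn : 1 ≤ n) (L : Link n) : L.carrier.Nonempty := by
  obtain ⟨h, κ, hκ, -, hL⟩ := L.tame
  obtain ⟨x, hx⟩ := (hκ ⟨0, hn⟩).nonempty
  have : (h '' L.carrier).Nonempty := ⟨x, hL ▸ mem_iUnion.2 ⟨_, hx⟩⟩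
  exact this.of_image

/-- Every connected spanning surface of a nonempty set can be made non-orientable at the cost of
one in the Euler characteristic. -/
theorem SpanningSurface.exists_nonorientable {L : Set E3} (hL : L.Nonempty)
    (S : SpanningSurface L) (hS : IsConnected S.carrier) :
    ∃ S' : SpanningSurface L, IsConnected S'.carrier ∧ ¬ S'.IsOrientable ∧ S'.χ = S.χ - 1 := by
  have hK : IsConnected S.K.space := S.h.isConnected_preimage.1 hS
  obtain ⟨G, Φ, h1, h2, h3, h4, h5⟩ := exists_glue_moebius S.isSurface hK
    (S.boundary_eq ▸ hL.image S.h)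
  refine ⟨⟨S.h.trans Φ, G, h1, ?_⟩, (S.h.trans Φ).isConnected_preimage.2 h2, h3, h4⟩
  rw [h5, S.boundary_eq, Set.image_image]
  rfl

end Genus

end LinkGenus

end


theorem mainTheorem4 (n : ℕ) (hn : 1 ≤ n) (L : LinkGenus.Link n) :
    LinkGenus.nonorientableGenus L ≤ 2 * LinkGenus.orientableGenus L + 1 := by
  have key : ∀ g ∈ {g : ℕ | ∃ S : LinkGenus.SpanningSurface L.carrier, IsConnected S.carrier ∧
      S.IsOrientable ∧ S.χ = 2 - 2 * (g : ℤ) - n},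
      LinkGenus.nonorientableGenus L ≤ 2 * (g : ℕ∞) + 1 := by
    rintro g ⟨S, hS, -, hχ⟩
    obtain ⟨S', h1, h2, h3⟩ := S.exists_nonorientable (L.carrier_nonempty hn) hS
    refine (iInf₂_le (2 * g + 1) ⟨S', h1, h2, ?_⟩).trans (by push_cast; exact le_rfl)
    rw [h3, hχ]
    push_cast
    ring
  unfold LinkGenus.orientableGenus
  generalize {g : ℕ | ∃ S : LinkGenus.SpanningSurface L.carrier, IsConnected S.carrier ∧
      S.IsOrientable ∧ S.χ = 2 - 2 * (g : ℤ) - n} = s at key ⊢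
  rcases s.eq_empty_or_nonempty with rfl | hs
  · simp
  · -- the infimum is attained
    have h : ⨅ g ∈ s, (g : ℕ∞) = ((sInf s : ℕ) : ℕ∞) :=
      le_antisymm (iInf₂_le _ (Nat.sInf_mem hs))
        (le_iInf₂ fun g hg => Nat.cast_le.2 (Nat.sInf_le hg))
    rw [h]
    exact key _ (Nat.sInf_mem hs)
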